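/- Let $\rho=e^{2\pi i/3}$, $\tau=\frac{1+\sqrt5}{2}$, and $$Z_1=\begin{pmatrix}1&0&0\\0&-1&0\\0&0&-1\end{pmatrix},\quad T_1=\begin{pmatrix}0&0&1\\1&0&0\\0&1&0\end{pmatrix},\quad P=\frac12\begin{pmatrix}1&\tau^{-1}&-\tau\\\tau^{-1}&\tau&1\\\tau&-1&\tau^{-1}\end{pmatrix},\quad Q=\begin{pmatrix}1&0&0\\0&0&\rho^2\\0&-\rho&0\end{pmatrix}.$$ Let $\mathcal V\subset \mathrm{PGL}_3(\mathbb C)$ be the Valentiner group, generated by the projective classes of $Z_1,T_1,P,Q$, and let $\mathcal V_{3\cdot 360}\subset \mathrm{SU}_3$ be the group of all elements of $\mathrm{SU}_3$ whose projective class lies in $\mathcal V$. Let $$\begin{aligned}F={}&x_1^6+x_2^6+x_3^6+3(5-\sqrt{15}\,i)\,x_1^2x_2^2x_3^2\\ &+\tfrac34\bigl(2\sqrt5-(5-\sqrt5)\rho\bigr)(x_1^4x_2^2+x_2^4x_3^2+x_1^2x_3^4)\\ &-\tfrac34\bigl(2\sqrt5+(5+\sqrt5)\rho^2\bigr)(x_1^4x_3^2+x_1^2x_2^4+x_2^2x_3^4)\end{aligned}$$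 be the basic Valentiner invariant of degree 6, and let $\Phi=-\frac1{20250}\det\bigl(\partial^2F/\partial x_i\partial x_j\bigr)$ be the invariant of degree 12 given by its Hessian determinant. Write $\nabla p=(\partial p/\partial x_1,\partial p/\partial x_2,\partial p/\partial x_3)$, let $\times$ be the cross product, and let $dX_2=(dx_2\wedge dx_3,\,dx_3\wedge dx_1,\,dx_1\wedge dx_2)$. A matrix $T\in \mathrm{SU}_3$ acts on a differential form $\omega$ on $\mathbb C^3$ by $(T\omega)(x)=\omega(T^{-1}x)$ (pullback under $T^{-1}$); the degree of a 2-form is the degree of its homogeneous polynomial coefficients. **Proposition.** One has $dF\wedge d\Phi=(\nabla F\times\nabla\Phi)\cdot dX_2$, and the space of $\mathcal V_{3\cdot360}$-invariant 2-forms of degree 16 on $\mathbb C^3$ is one-dimensional, spanned by $dF\wedge d\Phi$. Consequently $\psi_{16}=\nabla F\times\nabla\Phi$ is, up to scalar multiplication, the unique Valentiner equivariant of degree 16: the space of homogeneous polynomial maps $f:\mathbb C^3\to\mathbb C^3$ of degree 16 such that $f(Tx)=Tf(x)$ for all $T\in\mathcal V_{3\cdot360}$ is one-dimensional, spanned by $\psi_{16}$;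 and a homogeneous polynomial map $f$ of degree 16 is a scalar multiple of $\psi_{16}$ if and only if it is $\mathcal V$-equivariant, i.e. for every matrix $A\in\mathrm{GL}_3(\mathbb C)$ representing an element of $\mathcal V$ there is a constant $c\neq0$ such that $f(Ax)=c\,Af(x)$ for all $x$. -/

import Mathlib

open scoped Matrix MatrixGroups

noncomputable section

namespace Valentiner

/-! ### The Valentiner group -/

/-- The primitive cube root of unity `ρ = exp (2πi/3)`. -/
def rho : ℂ := Complex.exp (2 * Real.pi * Complex.I / 3)

/-- The real number `√5`, as a complex number. -/
def sqrtFive : ℂ := ((Real.sqrt 5 : ℝ) : ℂ)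

/-- The golden ratio `τ = (1 + √5) / 2`, as a complex number. -/
def tau : ℂ := (1 + sqrtFive) / 2

/-- The half-turn `Z₁` about the first coordinate axis. -/
def matZ : Matrix (Fin 3) (Fin 3) ℂ := !![1, 0, 0; 0, -1, 0; 0, 0, -1]

/-- The cyclic permutation `T₁` of the coordinates. Together with `Z₁` it generates the
tetrahedral group of the twelve rotations that preserve the set of vertices
`(1,1,1), (-1,-1,1), (1,-1,-1), (-1,1,-1)`. -/
def matT : Matrix (Fin 3) (Fin 3) ℂ := !![0, 0, 1; 1, 0, 0; 0, 1, 0]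

/-- The rotation `P` of order five that extends the tetrahedral group to an icosahedral group. -/
def matP : Matrix (Fin 3) (Fin 3) ℂ :=
  !![1 / 2, tau⁻¹ / 2, -tau / 2;
     tau⁻¹ / 2, tau / 2, 1 / 2;
     tau / 2, -1 / 2, tau⁻¹ / 2]

/-- The transformation `Q` of order four that extends the icosahedral group to the Valentiner
group. -/
def matQ : Matrix (Fin 3) (Fin 3) ℂ := !![1, 0, 0; 0, 0, rho ^ 2; 0, -rho, 0]

theorem sqrtFive_sq : sqrtFive ^ 2 = 5 := by
  unfold sqrtFive
  rw [← Complex.ofReal_pow, Real.sq_sqrt (by norm_num)]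
  norm_num

theorem tau_sq : tau ^ 2 = tau + 1 := by
  unfold tau
  linear_combination (1 / 4 : ℂ) * sqrtFive_sq

theorem tau_inv : tau⁻¹ = tau - 1 := by
  apply inv_eq_of_mul_eq_one_right
  linear_combination tau_sq

theorem star_tau : star tau = tau := by
  simp [tau, sqrtFive]

theorem rho_cube : rho ^ 3 = 1 := by
  unfold rho
  rw [← Complex.exp_nat_mul]
  have h : ((3 : ℕ) : ℂ) * (2 * Real.pi * Complex.I / 3) = 2 * Real.pi * Complex.I := by
    push_cast; ring
  rw [h, Complex.exp_two_pi_mul_I]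

theorem star_rho : star rho = rho ^ 2 := by
  have h1 : ‖rho‖ = 1 := by
    have h : (2 * Real.pi * Complex.I / 3 : ℂ) = ((2 * Real.pi / 3 : ℝ) : ℂ) * Complex.I := by
      push_cast; ring
    rw [rho, h, Complex.norm_exp_ofReal_mul_I]
  have h2 : rho * star rho = 1 := by
    have := Complex.mul_conj' rho
    rw [h1] at this
    simpa using this
  calc star rho = rho ^ 3 * star rho := by rw [rho_cube, one_mul]
    _ = rho ^ 2 * (rho * star rho) := by ring
    _ = rho ^ 2 := by rw [h2, mul_one]

theorem matZ_mem : matZ ∈ Matrix.specialUnitaryGroup (Fin 3) ℂ := by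
  rw [Matrix.mem_specialUnitaryGroup_iff, Matrix.mem_unitaryGroup_iff]
  refine ⟨?_, by simp [matZ, Matrix.det_fin_three]⟩
  ext i j
  fin_cases i <;> fin_cases j <;>
    simp [matZ, Matrix.mul_apply, Fin.sum_univ_three, Matrix.star_apply]

theorem matT_mem : matT ∈ Matrix.specialUnitaryGroup (Fin 3) ℂ := by
  rw [Matrix.mem_specialUnitaryGroup_iff, Matrix.mem_unitaryGroup_iff]
  refine ⟨?_, by simp [matT, Matrix.det_fin_three]⟩
  ext i j
  fin_cases i <;> fin_cases j <;>
    simp [matT, Matrix.mul_apply, Fin.sum_univ_three, Matrix.star_apply]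

theorem matP_mem : matP ∈ Matrix.specialUnitaryGroup (Fin 3) ℂ := by
  have ht := tau_sq
  have hs : (starRingEnd ℂ) tau = tau := star_tau
  have h2 : (starRingEnd ℂ) 2 = 2 := Complex.conj_ofNat 2
  rw [Matrix.mem_specialUnitaryGroup_iff, Matrix.mem_unitaryGroup_iff]
  constructor
  · ext i j
    fin_cases i <;> fin_cases j <;>
      simp [matP, Matrix.mul_apply, Fin.sum_univ_three, Matrix.star_apply, hs, h2, tau_inv] <;>
      grind
  · simp [matP, Matrix.det_fin_three, tau_inv]
    grind

theorem matQ_mem : matQ ∈ Matrix.specialUnitaryGroup (Fin 3) ℂ := by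
  have ht := rho_cube
  have hs : (starRingEnd ℂ) rho = rho ^ 2 := star_rho
  rw [Matrix.mem_specialUnitaryGroup_iff, Matrix.mem_unitaryGroup_iff]
  constructor
  · ext i j
    fin_cases i <;> fin_cases j <;>
      simp [matQ, Matrix.mul_apply, Fin.sum_univ_three, Matrix.star_apply, hs] <;>
      grind
  · simp [matQ, Matrix.det_fin_three]
    grind

/-- The group `SU₃`. -/
abbrev SU3 : Type := Matrix.specialUnitaryGroup (Fin 3) ℂ

/-- The projectivization `SU₃ → PGL₃(ℂ)`. -/
def toPGL : SU3 →* PGL(3, ℂ) :=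
  Matrix.ProjGenLinGroup.mk.comp
    (MonoidHom.toHomUnits (Matrix.specialUnitaryGroup (Fin 3) ℂ).subtype)

/-- The Valentiner group `𝒱 ⊂ PGL₃(ℂ)`, generated by the projective classes of
`Z₁`, `T₁`, `P` and `Q`. -/
def valentinerGroup : Subgroup PGL(3, ℂ) :=
  Subgroup.closure
    {toPGL ⟨matZ, matZ_mem⟩, toPGL ⟨matT, matT_mem⟩, toPGL ⟨matP, matP_mem⟩,
      toPGL ⟨matQ, matQ_mem⟩}

/-- The linear Valentiner group `𝒱_{3·360}`: the 1-to-3 lift of `𝒱` to `SU₃`, that is, the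
group of all elements of `SU₃` whose projective class belongs to `𝒱`. -/
def linearValentinerGroup : Subgroup SU3 :=
  valentinerGroup.comap toPGL

/-! ### The basic invariants of degrees 6 and 12 -/

open MvPolynomial in
/-- The invariant `F` of degree 6, normalized so that `x₁⁶` has coefficient 1.
The variables `x₁, x₂, x₃` are `X 0, X 1, X 2`. -/
def formF : MvPolynomial (Fin 3) ℂ :=
  X 0 ^ 6 + X 1 ^ 6 + X 2 ^ 6
    + C (3 * (5 - ((Real.sqrt 15 : ℝ) : ℂ) * Complex.I)) * (X 0 ^ 2 * X 1 ^ 2 * X 2 ^ 2)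
    + C (3 / 4 * (2 * sqrtFive - (5 - sqrtFive) * rho)) *
        (X 0 ^ 4 * X 1 ^ 2 + X 1 ^ 4 * X 2 ^ 2 + X 0 ^ 2 * X 2 ^ 4)
    - C (3 / 4 * (2 * sqrtFive + (5 + sqrtFive) * rho ^ 2)) *
        (X 0 ^ 4 * X 2 ^ 2 + X 0 ^ 2 * X 1 ^ 4 + X 1 ^ 2 * X 2 ^ 4)

/-- The Hessian matrix of a polynomial in three variables. -/
def hessian (p : MvPolynomial (Fin 3) ℂ) : Matrix (Fin 3) (Fin 3) (MvPolynomial (Fin 3) ℂ) :=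
  Matrix.of fun i j => MvPolynomial.pderiv i (MvPolynomial.pderiv j p)

/-- The invariant `Φ` of degree 12: the normalized Hessian determinant of `F`. -/
def formPhi : MvPolynomial (Fin 3) ℂ :=
  MvPolynomial.C (-1 / 20250) * (hessian formF).det

/-! ### Polynomial maps and polynomial differential forms on `ℂ³` -/

/-- A polynomial map `ℂ³ → ℂ³`, given by its coordinate polynomials. -/
abbrev PolyMap : Type := Fin 3 → MvPolynomial (Fin 3) ℂ

/-- The value of a polynomial map at a point. -/
def PolyMap.evalAt (f : PolyMap) (x : Fin 3 → ℂ) : Fin 3 → ℂ :=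
  fun i => MvPolynomial.eval x (f i)

/-- The formal gradient `∇p = (∂p/∂x₁, ∂p/∂x₂, ∂p/∂x₃)`. -/
def grad (p : MvPolynomial (Fin 3) ℂ) : PolyMap :=
  fun i => MvPolynomial.pderiv i p

/-- The map `ψ₁₆ = ∇F × ∇Φ`. -/
def psi16 : PolyMap := crossProduct (grad formF) (grad formPhi)

/-- A differential 1-form on `ℂ³`. -/
abbrev OneForm : Type := (Fin 3 → ℂ) → ((Fin 3 → ℂ) →ₗ[ℂ] ℂ)

/-- A differential 2-form on `ℂ³`: an alternating bilinear form on the tangent space at each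
point. -/
abbrev TwoForm : Type := (Fin 3 → ℂ) → ((Fin 3 → ℂ) [⋀^Fin 2]→ₗ[ℂ] ℂ)

/-- The differential `dp` of a polynomial, `dp(x)(v) = ∑ᵢ (∂p/∂xᵢ)(x) vᵢ`. -/
def differential (p : MvPolynomial (Fin 3) ℂ) : OneForm := fun x =>
  ∑ i, MvPolynomial.eval x (MvPolynomial.pderiv i p) • LinearMap.proj i

/-- The exterior product of two linear forms, `(a ∧ b)(u, v) = a(u) b(v) - a(v) b(u)`. -/
def wedgeLin (a b : (Fin 3 → ℂ) →ₗ[ℂ] ℂ) : (Fin 3 → ℂ) [⋀^Fin 2]→ₗ[ℂ] ℂ :=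
  MultilinearMap.alternatization
    ((MultilinearMap.mkPiAlgebra ℂ (Fin 2) ℂ).compLinearMap ![a, b])

theorem wedgeLin_apply (a b : (Fin 3 → ℂ) →ₗ[ℂ] ℂ) (u : Fin 2 → Fin 3 → ℂ) :
    wedgeLin a b u = a (u 0) * b (u 1) - a (u 1) * b (u 0) := by
  have h : (Finset.univ : Finset (Equiv.Perm (Fin 2))) = {1, Equiv.swap 0 1} := by decide
  rw [wedgeLin, MultilinearMap.alternatization_apply, h,
    Finset.sum_pair (by decide)]
  simp [Fin.prod_univ_two, sub_eq_add_neg]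

/-- The exterior product of two differential 1-forms. -/
def wedge (α β : OneForm) : TwoForm := fun x => wedgeLin (α x) (β x)

/-- The 2-form `f · dX₂ = f₁ dx₂ ∧ dx₃ + f₂ dx₃ ∧ dx₁ + f₃ dx₁ ∧ dx₂`. -/
def dotdX2 (f : PolyMap) : TwoForm := fun x =>
  f.evalAt x 0 • wedgeLin (LinearMap.proj 1) (LinearMap.proj 2)
    + f.evalAt x 1 • wedgeLin (LinearMap.proj 2) (LinearMap.proj 0)
    + f.evalAt x 2 • wedgeLin (LinearMap.proj 0) (LinearMap.proj 1)

/-- The action of `SU₃` on 2-forms, `(T ω)(x) = ω(T⁻¹ x)`, where `T⁻¹` is also substituted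
into the differentials; in other words the pullback of `ω` under `T⁻¹`. -/
def actOnTwoForm (T : SU3) (ω : TwoForm) : TwoForm := fun x =>
  (ω (((T⁻¹ : SU3) : Matrix (Fin 3) (Fin 3) ℂ) *ᵥ x)).compLinearMap
    (Matrix.mulVecLin ((T⁻¹ : SU3) : Matrix (Fin 3) (Fin 3) ℂ))

/-- The space of 2-forms on `ℂ³` that are homogeneous polynomial of degree `m` (that is, their
coefficients are homogeneous polynomials of degree `m`) and invariant under `G`. -/
def invariantTwoForms (G : Subgroup SU3) (m : ℕ) : Submodule ℂ TwoForm where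
  carrier := {ω |
    (∀ u : Fin 2 → Fin 3 → ℂ, ∃ p : MvPolynomial (Fin 3) ℂ,
      p.IsHomogeneous m ∧ ∀ x, ω x u = MvPolynomial.eval x p) ∧
    ∀ T ∈ G, actOnTwoForm T ω = ω}
  zero_mem' :=
    ⟨fun _ => ⟨0, MvPolynomial.isHomogeneous_zero _ _ _, fun _ => by simp⟩, fun _ _ => rfl⟩
  add_mem' := by
    rintro ω η ⟨h1, h2⟩ ⟨k1, k2⟩
    refine ⟨fun u => ?_, fun T hT => ?_⟩
    · obtain ⟨p, hp, hp'⟩ := h1 u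
      obtain ⟨q, hq, hq'⟩ := k1 u
      exact ⟨p + q, hp.add hq, fun x => by simp [hp', hq']⟩
    · conv_rhs => rw [← h2 T hT, ← k2 T hT]
      rfl
  smul_mem' := by
    rintro c ω ⟨h1, h2⟩
    refine ⟨fun u => ?_, fun T hT => ?_⟩
    · obtain ⟨p, hp, hp'⟩ := h1 u
      refine ⟨MvPolynomial.C c * p, ?_, fun x => by simp [hp']⟩
      simpa using (MvPolynomial.isHomogeneous_C (Fin 3) c).mul hp
    · conv_rhs => rw [← h2 T hT]
      rfl

/-- The space of homogeneous polynomial maps `f : ℂ³ → ℂ³` of degree `m` that commute with the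
linear action of `G`: `f (T x) = T f(x)` for all `T ∈ G`. -/
def equivariantMaps (G : Subgroup SU3) (m : ℕ) : Submodule ℂ PolyMap where
  carrier := {f |
    (∀ i, (f i).IsHomogeneous m) ∧
    ∀ T ∈ G, ∀ x : Fin 3 → ℂ,
      f.evalAt ((T : Matrix (Fin 3) (Fin 3) ℂ) *ᵥ x) =
        (T : Matrix (Fin 3) (Fin 3) ℂ) *ᵥ f.evalAt x}
  zero_mem' :=
    ⟨fun _ => MvPolynomial.isHomogeneous_zero _ _ _, fun T _ x => by
      have h : ∀ y, PolyMap.evalAt 0 y = 0 := fun y => by ext i; simp [PolyMap.evalAt]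
      rw [h, h, Matrix.mulVec_zero]⟩
  add_mem' := by
    rintro f g ⟨h1, h2⟩ ⟨k1, k2⟩
    refine ⟨fun i => (h1 i).add (k1 i), fun T hT x => ?_⟩
    have h : ∀ y, PolyMap.evalAt (f + g) y = f.evalAt y + g.evalAt y := fun y => by
      ext i; simp [PolyMap.evalAt]
    rw [h, h, Matrix.mulVec_add, h2 T hT, k2 T hT]
  smul_mem' := by
    rintro c f ⟨h1, h2⟩
    refine ⟨fun i => ?_, fun T hT x => ?_⟩
    · have := (MvPolynomial.isHomogeneous_C (Fin 3) c).mul (h1 i)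
      rw [zero_add] at this
      simpa [MvPolynomial.smul_eq_C_mul] using this
    · have h : ∀ y, PolyMap.evalAt (c • f) y = c • f.evalAt y := fun y => by
        ext i; simp [PolyMap.evalAt]
      rw [h, h, Matrix.mulVec_smul, h2 T hT]

/-- A polynomial map is projectively equivariant under a subgroup `H` of `PGL₃(ℂ)` if, for each
matrix `A` that represents an element of `H`, the maps `f ∘ A` and `A ∘ f` agree up to a
nonzero constant (which may depend on `A`). -/
def IsProjEquivariant (H : Subgroup PGL(3, ℂ)) (f : PolyMap) : Prop :=
  ∀ A : GL (Fin 3) ℂ, (Matrix.ProjGenLinGroup.mk A : PGL(3, ℂ)) ∈ H →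
    ∃ c : ℂ, c ≠ 0 ∧ ∀ x : Fin 3 → ℂ,
      f.evalAt ((A : Matrix (Fin 3) (Fin 3) ℂ) *ᵥ x) =
        c • ((A : Matrix (Fin 3) (Fin 3) ℂ) *ᵥ f.evalAt x)

end Valentiner

end

noncomputable section

namespace Valentiner

/-! ### The order `ℤ[τ, ρ]` -/

/-! Everything reduces to two facts about equivariants of degree 16: the space has dimension at most
one, and `psi16` is a nonzero element of it.

Upper bound. Equivariance under `matT` makes the three coordinates cyclic shifts of the first one.
Equivariance under `matZ` and `matQ` forces that coordinate into a space of dimension 16, spanned by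
the functions `basisFun` with c < b and b + c ≤ 7. Once the coefficient of y^15 z is set to zero, 15
unknowns remain, and equivariance under `matP`, tested at 15 integer points, gives a square
homogeneous system over ℤ[τ, ρ]. Its determinant is nonzero because it remains nonzero in a residue
field of 31 elements (`sampleMatrix_det_ne_zero`). So that single coefficient determines an
equivariant (`eq_zero_of_coeff_eq_zero`).

Existence. The four generators have determinant 1 and preserve F; the hardest case is
`eval_formF_matP`. By the chain rule they also preserve the Hessian determinant Φ. Gradients of
invariants transform contragrediently, and under a matrix of determinant 1 the cross product of two
covectors transforms as a vector, so `commutesWith_psi16` holds. An evaluation at (1,1,0) shows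
`psi16_ne_zero`. An arbitrary element of the linear group is such a matrix times a cube root of
unity c, which is harmless because c^15 = 1 (`psi16_mem_equivariantMaps`).

The other two statements follow. For a projective equivariant, the constants attached to the
generators satisfy the relations between these matrices, which force them to be 1
(`IsProjEquivariant.commutesWith`). For 2-forms, f ↦ f · dX₂ identifies equivariant maps with
invariant forms for every subgroup of SU₃ (`invariantTwoForms_eq_map`). -/

/-- The ring `ℤ[t]` with `t² = t + 1`. -/
abbrev GoldenInt : Type := QuadraticAlgebra ℤ 1 1

/-- The ring `ℤ[t, r]` with `t² = t + 1` and `r² = -1 - r`. -/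
abbrev GoldenEisenstein : Type := QuadraticAlgebra GoldenInt (-1) (-1)

namespace GoldenEisenstein

/-- The generator `t` with `t² = t + 1`. -/
def t : GoldenEisenstein := ⟨⟨0, 1⟩, 0⟩

/-- The generator `r` with `r² = -1 - r`. -/
def r : GoldenEisenstein := ⟨0, 1⟩

theorem exists_ringHom {A : Type} [CommRing A] {a b : A} (ha : a * a = a + 1)
    (hb : b * b = -1 - b) :
    ∃ φ : GoldenEisenstein →+* A, φ t = a ∧ φ r = b ∧
      ∀ z, φ z = z.re.re + z.re.im * a + (z.im.re + z.im.im * a) * b := by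
  let φ₁ : GoldenInt →ₐ[ℤ] A := QuadraticAlgebra.lift ⟨a, by simp [ha, add_comm]⟩
  -- Viewing A as an algebra over the first quadratic ring through `φ₁` lets the universal property
  -- apply a second time, to adjoin the image of r.
  let _ : Algebra GoldenInt A := φ₁.toRingHom.toAlgebra
  have h₁ : ∀ z : GoldenInt, algebraMap GoldenInt A z = z.re + z.im * a := by
    intro z
    change z.re • (1 : A) + z.im • a = _
    simp
  let φ₂ : GoldenEisenstein →ₐ[GoldenInt] A :=
    QuadraticAlgebra.lift ⟨b, by simp [hb, sub_eq_add_neg]⟩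
  have h₂ : ∀ z, φ₂ z = z.re.re + z.re.im * a + (z.im.re + z.im.im * a) * b := by
    intro z
    change z.re • (1 : A) + z.im • b = _
    rw [Algebra.smul_def, Algebra.smul_def, h₁, h₁, mul_one]
  refine ⟨φ₂.toRingHom, ?_, ?_, h₂⟩
  · exact (h₂ t).trans (by simp [t])
  · exact (h₂ r).trans (by simp [r, QuadraticAlgebra.re_one, QuadraticAlgebra.im_one])

end GoldenEisenstein

/-! ### Independence of 1, τ, ρ, τρ over ℤ -/

theorem rho_eq : rho = -1 / 2 + (Real.sqrt 3 : ℝ) / 2 * Complex.I := by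
  have h : (2 * Real.pi * Complex.I / 3 : ℂ) = ((Real.pi - Real.pi / 3 : ℝ) : ℂ) * Complex.I := by
    push_cast; ring
  rw [rho, h, Complex.exp_mul_I, ← Complex.ofReal_cos, ← Complex.ofReal_sin, Real.cos_pi_sub,
    Real.sin_pi_sub, Real.cos_pi_div_three, Real.sin_pi_div_three]
  push_cast; ring

theorem rho_sq : rho ^ 2 = -1 - rho := by
  have h3 : ((Real.sqrt 3 : ℝ) : ℂ) ^ 2 = 3 := by
    rw [← Complex.ofReal_pow, Real.sq_sqrt (by norm_num)]; norm_num
  rw [rho_eq]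
  linear_combination (1 / 4 * Complex.I ^ 2) * h3 + (3 / 4) * Complex.I_sq

theorem rho_im_ne_zero : rho.im ≠ 0 := by
  intro h
  have h1 : rho = (rho.re : ℂ) := Complex.ext rfl (by simpa using h)
  have h2 := rho_sq
  rw [h1] at h2
  have h3 : rho.re ^ 2 = -1 - rho.re := by exact_mod_cast h2
  nlinarith [sq_nonneg (rho.re + 1 / 2)]

theorem int_add_int_mul_golden_eq_zero {a b : ℤ} (h : (a : ℝ) + b * ((1 + Real.sqrt 5) / 2) = 0) :
    a = 0 ∧ b = 0 := by
  have hb : b = 0 := by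
    by_contra hb
    have hirr : Irrational (Real.sqrt 5) := by
      simpa using Nat.Prime.irrational_sqrt (p := 5) (by norm_num)
    -- Solving the relation for √5 when b ≠ 0 gives this rational number.
    refine hirr ⟨(-2 * a / b - 1 : ℚ), ?_⟩
    have : (b : ℝ) ≠ 0 := by exact_mod_cast hb
    push_cast
    field_simp
    linear_combination -2 * h
  subst hb
  simpa using h

/-- Since τ is real and ρ is not, the imaginary part isolates c + dτ; both real combinations then
vanish, and the irrationality of √5 finishes. -/
theorem int_combination_eq_zero {a b c d : ℤ}
    (h : (a + b * tau + (c + d * tau) * rho : ℂ) = 0) : a = 0 ∧ b = 0 ∧ c = 0 ∧ d = 0 := by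
  set g : ℝ := (1 + Real.sqrt 5) / 2 with hg
  have ht : tau = (g : ℂ) := by simp [tau, sqrtFive, hg]
  have h' : (((a + b * g : ℝ) : ℂ) + ((c + d * g : ℝ) : ℂ) * rho) = 0 := by
    rw [← h, ht]; push_cast; ring
  have him := congrArg Complex.im h'
  rw [Complex.add_im, Complex.ofReal_im, Complex.im_ofReal_mul, zero_add, Complex.zero_im] at him
  have hcd := (mul_eq_zero.1 him).resolve_right rho_im_ne_zero
  rw [hcd] at h'
  have hab : (a + b * g : ℝ) = 0 := by
    have := congrArg Complex.re h'
    simpa using this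
  obtain ⟨h1, h2⟩ := int_add_int_mul_golden_eq_zero hab
  obtain ⟨h3, h4⟩ := int_add_int_mul_golden_eq_zero hcd
  exact ⟨h1, h2, h3, h4⟩

/-- The order embeds in `ℂ` and has the residue field of 31 elements at `(31, t - 13, r - 5)`. -/
theorem exists_goldenEisenstein_homs :
    ∃ (φ : GoldenEisenstein →+* ℂ) (χ : GoldenEisenstein →+* ZMod 31),
      Function.Injective φ ∧ φ GoldenEisenstein.t = tau ∧ φ GoldenEisenstein.r = rho ∧
      χ GoldenEisenstein.t = 13 ∧ χ GoldenEisenstein.r = 5 := by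
  obtain ⟨φ, h1, h2, h3⟩ := GoldenEisenstein.exists_ringHom (a := tau) (b := rho)
    (by linear_combination tau_sq) (by linear_combination rho_sq)
  obtain ⟨χ, k1, k2, -⟩ := GoldenEisenstein.exists_ringHom (A := ZMod 31) (a := 13) (b := 5)
    (by decide) (by decide)
  refine ⟨φ, χ, (injective_iff_map_eq_zero φ).2 fun z hz => ?_, h1, h2, k1, k2⟩
  rw [h3] at hz
  obtain ⟨e1, e2, e3, e4⟩ := int_combination_eq_zero hz
  ext <;> simpa

/-! ### The linear system for equivariants of degree 16 -/

/-- The polynomial functions `x^(14-2b-2c) (y^(2b+1) z^(2c+1) - r^(b-c) y^(2c+1) z^(2b+1))` that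
span the possible first coordinates of the equivariants of degree 16 under the monomial part of
the group. -/
def basisFun {R : Type} [CommRing R] (r x y z : R) (b c : ℕ) : R :=
  x ^ (14 - 2 * b - 2 * c) *
    (y ^ (2 * b + 1) * z ^ (2 * c + 1) - r ^ (b - c) * (y ^ (2 * c + 1) * z ^ (2 * b + 1)))

/-- The defect of equivariance under `P` of the map with first coordinate `basisFun`. -/
def defect {R : Type} [CommRing R] (t r x y z : R) (b c : ℕ) : R :=
  basisFun r (x + (t - 1) * y - t * z) ((t - 1) * x + t * y + z) (t * x - y + (t - 1) * z) b c
    - 2 ^ 15 * (basisFun r x y z b c + (t - 1) * basisFun r y z x b c - t * basisFun r z x y b c)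

theorem map_basisFun {R S : Type} [CommRing R] [CommRing S] (φ : R →+* S) (r x y z : R)
    (b c : ℕ) : φ (basisFun r x y z b c) = basisFun (φ r) (φ x) (φ y) (φ z) b c := by
  simp [basisFun]

theorem map_defect {R S : Type} [CommRing R] [CommRing S] (φ : R →+* S) (t r x y z : R)
    (b c : ℕ) : φ (defect t r x y z b c) = defect (φ t) (φ r) (φ x) (φ y) (φ z) b c := by
  have h2 : φ 2 = 2 := map_ofNat φ 2
  simp [defect, map_basisFun, h2]

/-- The exponents `b` of the basis functions. -/
def expB : Fin 15 → ℕ := ![1, 2, 2, 3, 3, 3, 4, 4, 4, 4, 5, 5, 5, 6, 6]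

/-- The exponents `c` of the basis functions. -/
def expC : Fin 15 → ℕ := ![0, 0, 1, 0, 1, 2, 0, 1, 2, 3, 0, 1, 2, 0, 1]

/-- The sample points at which the defect is evaluated. -/
def samplePt : Fin 15 → ℤ × ℤ × ℤ :=
  ![(1, 0, 0), (0, 1, 0), (0, 0, 1), (1, 1, 0), (1, 0, 1), (0, 1, 1), (1, 0, -1), (1, -1, 0),
    (0, 1, -1), (1, 1, 1), (2, 1, 0), (2, 0, 1), (1, 2, 0), (1, 0, 2), (0, 2, 1)]

/-- The matrix of the linear system. -/
def sampleMatrix {R : Type} [CommRing R] (t r : R) : Matrix (Fin 15) (Fin 15) R :=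
  Matrix.of fun i j =>
    defect t r (samplePt i).1 (samplePt i).2.1 (samplePt i).2.2 (expB j) (expC j)

/-- The inverse of the matrix of the linear system modulo 31. -/
def sampleMatrixInv : Matrix (Fin 15) (Fin 15) (ZMod 31) :=
  ![![28, 16, 19, 27, 3, 12, 30, 22, 23, 7, 4, 20, 27, 30, 10],
  ![12, 1, 21, 19, 6, 13, 26, 25, 26, 19, 0, 2, 8, 22, 20],
  ![24, 7, 23, 14, 24, 4, 5, 9, 29, 4, 3, 23, 19, 0, 14],
  ![23, 10, 14, 20, 18, 19, 7, 29, 14, 9, 26, 25, 28, 2, 30],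
  ![15, 30, 4, 4, 19, 9, 17, 16, 3, 10, 23, 29, 1, 19, 1],
  ![20, 29, 8, 14, 1, 4, 16, 15, 2, 0, 7, 26, 1, 22, 10],
  ![15, 20, 29, 17, 21, 11, 0, 20, 7, 15, 26, 6, 8, 0, 18],
  ![30, 23, 7, 26, 6, 20, 5, 24, 25, 25, 6, 11, 0, 13, 20],
  ![11, 17, 6, 16, 7, 18, 21, 24, 13, 5, 0, 3, 18, 20, 5],
  ![4, 8, 18, 0, 17, 27, 6, 16, 4, 22, 6, 18, 21, 9, 5],
  ![29, 0, 13, 12, 25, 30, 30, 18, 26, 11, 13, 18, 8, 1, 18],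
  ![17, 27, 30, 14, 5, 28, 2, 23, 18, 12, 22, 13, 26, 24, 19],
  ![29, 27, 22, 0, 7, 2, 28, 23, 29, 30, 28, 22, 5, 11, 13],
  ![29, 4, 19, 14, 24, 4, 30, 15, 6, 23, 27, 11, 5, 19, 18],
  ![27, 2, 9, 12, 12, 1, 6, 5, 6, 19, 10, 7, 27, 1, 9]]

theorem sampleMatrixInv_mul : sampleMatrixInv * sampleMatrix 13 5 = 1 := by
  decide +kernel

theorem map_sampleMatrix {R S : Type} [CommRing R] [CommRing S] (φ : R →+* S) (t r : R) :
    φ.mapMatrix (sampleMatrix t r) = sampleMatrix (φ t) (φ r) := by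
  ext i j
  simp [sampleMatrix, map_defect]

/-- The entries lie in ℤ[τ, ρ], so the determinant can be reduced modulo a prime of that order. In
the residue field of 31 elements the reduced matrix has an explicit left inverse, so its determinant
cannot be 0. -/
theorem sampleMatrix_det_ne_zero : (sampleMatrix tau rho).det ≠ 0 := by
  obtain ⟨φ, χ, hφ, h1, h2, k1, k2⟩ := exists_goldenEisenstein_homs
  rw [← h1, ← h2, ← map_sampleMatrix, ← RingHom.map_det]
  intro h
  have h0 : (sampleMatrix GoldenEisenstein.t GoldenEisenstein.r).det = 0 :=
    (map_eq_zero_iff φ hφ).1 h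
  have h3 := congrArg χ h0
  rw [RingHom.map_det, map_sampleMatrix, k1, k2, map_zero] at h3
  have h4 := congrArg Matrix.det sampleMatrixInv_mul
  rw [Matrix.det_mul, h3, mul_zero, Matrix.det_one] at h4
  exact absurd h4 (by decide)

/-! ### Uniqueness of the equivariant of degree 16 -/

open MvPolynomial in
theorem sum_eq_of_coeff_ne_zero {p : MvPolynomial (Fin 3) ℂ} {n : ℕ} (hp : p.IsHomogeneous n)
    {d : Fin 3 →₀ ℕ} (hd : coeff d p ≠ 0) : ∑ i, d i = n := by
  rw [← Finsupp.degree_eq_sum, Finsupp.degree_eq_weight_one (R := ℕ)]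
  exact hp hd

open MvPolynomial in
theorem eval_bind₁ (g : Fin 3 → MvPolynomial (Fin 3) ℂ) (p : MvPolynomial (Fin 3) ℂ)
    (x : Fin 3 → ℂ) : eval x (bind₁ g p) = eval (fun i => eval x (g i)) p :=
  eval₂Hom_bind₁ _ _ _ _

open MvPolynomial in
theorem eval_smul_of_isHomogeneous {p : MvPolynomial (Fin 3) ℂ} {n : ℕ} (hp : p.IsHomogeneous n)
    (c : ℂ) (x : Fin 3 → ℂ) : eval (c • x) p = c ^ n * eval x p := by
  rw [eval_eq', eval_eq', Finset.mul_sum]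
  refine Finset.sum_congr rfl fun d hd => ?_
  have hn : ∑ i, d i = n := sum_eq_of_coeff_ne_zero hp (mem_support_iff.1 hd)
  simp only [Pi.smul_apply, smul_eq_mul, mul_pow, Finset.prod_mul_distrib,
    Finset.prod_pow_eq_pow_sum, hn]
  ring

theorem PolyMap.evalAt_smul {f : PolyMap} {n : ℕ} (hf : ∀ i, (f i).IsHomogeneous n)
    (c : ℂ) (x : Fin 3 → ℂ) : f.evalAt (c • x) = c ^ n • f.evalAt x := by
  ext i
  simp [PolyMap.evalAt, eval_smul_of_isHomogeneous (hf i)]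

theorem PolyMap.ext_evalAt {f g : PolyMap} (h : ∀ x, f.evalAt x = g.evalAt x) : f = g :=
  funext fun i => MvPolynomial.funext fun x => congrFun (h x) i

/-- The exponent vector of the monomial `x^a y^b z^c`. -/
def expVec (a b c : ℕ) : Fin 3 →₀ ℕ := Finsupp.equivFunOnFinite.symm ![a, b, c]

theorem expVec_apply (a b c : ℕ) (i : Fin 3) : expVec a b c i = ![a, b, c] i := rfl

theorem cons_eta (x : Fin 3 → ℂ) : ![x 0, x 1, x 2] = x := by
  ext i
  fin_cases i <;> rfl

theorem eq_expVec (d : Fin 3 →₀ ℕ) : d = expVec (d 0) (d 1) (d 2) := by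
  ext i
  fin_cases i <;> rfl

open MvPolynomial in
theorem coeff_bind₁_C_mul_X (p : MvPolynomial (Fin 3) ℂ) (a : Fin 3 → ℂ) (d : Fin 3 →₀ ℕ) :
    coeff d (bind₁ (fun i => C (a i) * X i) p) = (∏ i, a i ^ d i) * coeff d p := by
  induction p using MvPolynomial.induction_on' with
  | monomial u c =>
    have : bind₁ (fun i => C (a i) * X i) (monomial u c) =
        monomial u ((∏ i, a i ^ u i) * c) := by
      rw [bind₁_monomial, monomial_eq (s := u)]
      unfold Finsupp.prod
      simp only [mul_pow, Finset.prod_mul_distrib, map_mul, map_prod, map_pow]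
      rw [Finset.prod_subset (Finset.subset_univ u.support) (f := fun i => C (a i) ^ u i)]
      · ring
      · intro i _ hi
        rw [Finsupp.notMem_support_iff.1 hi, pow_zero]
    rw [this, coeff_monomial, coeff_monomial]
    split_ifs with h
    · rw [h]
    · rw [mul_zero]
  | add p q hp hq => rw [map_add, coeff_add, hp, hq, coeff_add, mul_add]

open MvPolynomial in
/-- Comparison of coefficients for a polynomial that is semi-invariant under a diagonal
substitution. -/
theorem coeff_eq_of_eval_diagonal {p : MvPolynomial (Fin 3) ℂ} {a b c s : ℂ}
    (h : ∀ x y z, eval ![a * x, b * y, c * z] p = s * eval ![x, y, z] p) (i j k : ℕ) :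
    a ^ i * b ^ j * c ^ k * coeff (expVec i j k) p = s * coeff (expVec i j k) p := by
  have h1 : bind₁ (fun i => C (![a, b, c] i) * X i) p = C s * p := by
    refine MvPolynomial.funext fun x => ?_
    have := h (x 0) (x 1) (x 2)
    rw [eval_bind₁, map_mul, eval_C]
    rw [cons_eta] at this
    convert this using 3
    ext l
    fin_cases l <;> simp
  have h2 := congrArg (coeff (expVec i j k)) h1
  rw [coeff_bind₁_C_mul_X, coeff_C_mul] at h2
  simpa [Fin.prod_univ_three, expVec_apply] using h2

open MvPolynomial in
/-- Comparison of coefficients for a polynomial that is invariant under a monomial substitution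
that interchanges the last two variables. -/
theorem coeff_eq_of_eval_swap {p : MvPolynomial (Fin 3) ℂ} {b c : ℂ}
    (h : ∀ x y z, eval ![x, b * z, c * y] p = eval ![x, y, z] p) (i j k : ℕ) :
    coeff (expVec i k j) p = b ^ j * c ^ k * coeff (expVec i j k) p := by
  have h1 : rename (Equiv.swap 1 2) (bind₁ (fun i => C (![1, b, c] i) * X i) p) = p := by
    refine MvPolynomial.funext fun x => ?_
    have := h (x 0) (x 1) (x 2)
    rw [eval_rename, eval_bind₁]
    rw [cons_eta] at this
    conv_rhs => rw [← this]
    congr 2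
    ext i
    fin_cases i <;> simp [Equiv.swap_apply_of_ne_of_ne]
  have h2 : (expVec i j k).mapDomain (Equiv.swap (1 : Fin 3) 2) = expVec i k j := by
    rw [← Finsupp.equivMapDomain_eq_mapDomain]
    ext l
    fin_cases l <;> simp [Finsupp.equivMapDomain_apply, expVec_apply, Equiv.swap_apply_of_ne_of_ne]
  rw [← h2]
  conv_lhs => rw [← h1]
  rw [coeff_rename_mapDomain _ (Equiv.swap (1 : Fin 3) 2).injective, coeff_bind₁_C_mul_X]
  simp [Fin.prod_univ_three, expVec_apply]

open MvPolynomial in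
/-- A homogeneous polynomial of degree 16 that is odd in the last two variables. -/
theorem eval_eq_sum_of_odd {p : MvPolynomial (Fin 3) ℂ} (hp : p.IsHomogeneous 16)
    (h : ∀ i j k, coeff (expVec i j k) p ≠ 0 → Odd j ∧ Odd k) (x y z : ℂ) :
    eval ![x, y, z] p = ∑ b ∈ Finset.range 8, ∑ c ∈ Finset.range (8 - b),
      coeff (expVec (14 - 2 * b - 2 * c) (2 * b + 1) (2 * c + 1)) p *
        (x ^ (14 - 2 * b - 2 * c) * y ^ (2 * b + 1) * z ^ (2 * c + 1)) := by
  rw [eval_eq', Finset.sum_sigma']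
  let e : (_ : ℕ) × ℕ → Fin 3 →₀ ℕ :=
    fun u => expVec (14 - 2 * u.1 - 2 * u.2) (2 * u.1 + 1) (2 * u.2 + 1)
  have he : Function.Injective e := by
    rintro ⟨b, c⟩ ⟨b', c'⟩ huv
    have h1 := DFunLike.congr_fun huv 1
    have h2 := DFunLike.congr_fun huv 2
    simp [e, expVec_apply] at h1 h2
    rw [h1, h2]
  have hsub : p.support ⊆ ((Finset.range 8).sigma fun b => Finset.range (8 - b)).image e := by
    intro d hd
    have hd' := mem_support_iff.1 hd
    have hn : d 0 + d 1 + d 2 = 16 := by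
      simpa [Fin.sum_univ_three] using sum_eq_of_coeff_ne_zero hp hd'
    rw [eq_expVec d] at hd'
    obtain ⟨⟨b, hb⟩, ⟨c, hc⟩⟩ := h _ _ _ hd'
    refine Finset.mem_image.2 ⟨⟨b, c⟩, ?_, ?_⟩
    · simp only [Finset.mem_sigma, Finset.mem_range]; omega
    · rw [eq_expVec d, hb, hc]
      have : d 0 = 14 - 2 * b - 2 * c := by omega
      rw [this]
  rw [Finset.sum_subset hsub, Finset.sum_image (he.injOn)]
  · refine Finset.sum_congr rfl fun u _ => ?_
    simp [e, Fin.prod_univ_three, expVec_apply]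
  · intro d _ hd
    rw [notMem_support_iff.1 hd, zero_mul]

/-- Equivariance of a polynomial map under a single matrix. -/
def CommutesWith (f : PolyMap) (A : Matrix (Fin 3) (Fin 3) ℂ) : Prop :=
  ∀ x, f.evalAt (A *ᵥ x) = A *ᵥ f.evalAt x

-- The hypotheses `h1`, `h2`, `h3` encode `matZ`, its conjugate by `matT`, and `matQ`. The two sign
-- changes leave only monomials odd in y and in z. The swap in `matQ` ties the coefficients of
-- y^(2b+1) z^(2c+1) and y^(2c+1) z^(2b+1) together. Of the 16 resulting functions, `h4` removes the
-- one with (b, c) = (7, 0).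
open MvPolynomial in
theorem eval_eq_sum_basisFun {p : MvPolynomial (Fin 3) ℂ} (hp : p.IsHomogeneous 16)
    (h1 : ∀ x y z, eval ![x, -y, -z] p = eval ![x, y, z] p)
    (h2 : ∀ x y z, eval ![-x, -y, z] p = -eval ![x, y, z] p)
    (h3 : ∀ x y z, eval ![x, rho ^ 2 * z, -rho * y] p = eval ![x, y, z] p)
    (h4 : coeff (expVec 0 15 1) p = 0) (x y z : ℂ) :
    eval ![x, y, z] p = ∑ j, basisFun rho x y z (expB j) (expC j) *
      coeff (expVec (14 - 2 * expB j - 2 * expC j) (2 * expB j + 1) (2 * expC j + 1)) p := by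
  have hodd : ∀ i j k, coeff (expVec i j k) p ≠ 0 → Odd j ∧ Odd k := by
    intro i j k hne
    have hdeg : i + j + k = 16 := by
      simpa [Fin.sum_univ_three, expVec_apply] using sum_eq_of_coeff_ne_zero hp hne
    have e1 := coeff_eq_of_eval_diagonal (a := 1) (b := -1) (c := -1) (s := 1)
      (fun x y z => by simpa using h1 x y z) i j k
    have e2 := coeff_eq_of_eval_diagonal (a := -1) (b := -1) (c := 1) (s := -1)
      (fun x y z => by simpa using h2 x y z) i j k
    have e1 := mul_right_cancel₀ hne e1
    have e2 := mul_right_cancel₀ hne e2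
    rw [one_pow, one_mul, ← pow_add, neg_one_pow_eq_one_iff_even (by norm_num)] at e1
    rw [one_pow, mul_one, ← pow_add, neg_one_pow_eq_neg_one_iff_odd (by norm_num)] at e2
    -- Here j + k is even, i + j is odd and i + j + k = 16, so j and k are both odd.
    grind
  have hswap : ∀ i b c, c ≤ b → coeff (expVec i (2 * c + 1) (2 * b + 1)) p =
      -rho ^ (b - c) * coeff (expVec i (2 * b + 1) (2 * c + 1)) p := by
    intro i b c hcb
    rw [coeff_eq_of_eval_swap h3 i (2 * b + 1) (2 * c + 1)]
    congr 1
    obtain ⟨k, rfl⟩ := Nat.exists_eq_add_of_le hcb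
    rw [Nat.add_sub_cancel_left]
    -- The total exponent of ρ is 6c + 4k + 3 with k = b - c, which is congruent to k modulo 3.
    have : (rho ^ 2) ^ (2 * (c + k) + 1) * (-rho) ^ (2 * c + 1) =
        -((rho ^ 3) ^ (2 * c + k + 1) * rho ^ k) := by
      rw [Odd.neg_pow (by simp)]
      ring
    rw [this, rho_cube]
    simp
  have hdiag : ∀ i b, coeff (expVec i (2 * b + 1) (2 * b + 1)) p = 0 := by
    intro i b
    have := hswap i b b le_rfl
    rw [Nat.sub_self, pow_zero] at this
    linear_combination this / 2
  rw [eval_eq_sum_of_odd hp hodd]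
  -- All pairs with b + c ≤ 7: `sbc` for c < b, and `d0` to `d3` for b = c.
  have s10 := hswap 12 1 0 (by norm_num)
  have s20 := hswap 10 2 0 (by norm_num)
  have s21 := hswap 8 2 1 (by norm_num)
  have s30 := hswap 8 3 0 (by norm_num)
  have s31 := hswap 6 3 1 (by norm_num)
  have s32 := hswap 4 3 2 (by norm_num)
  have s40 := hswap 6 4 0 (by norm_num)
  have s41 := hswap 4 4 1 (by norm_num)
  have s42 := hswap 2 4 2 (by norm_num)
  have s43 := hswap 0 4 3 (by norm_num)
  have s50 := hswap 4 5 0 (by norm_num)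
  have s51 := hswap 2 5 1 (by norm_num)
  have s52 := hswap 0 5 2 (by norm_num)
  have s60 := hswap 2 6 0 (by norm_num)
  have s61 := hswap 0 6 1 (by norm_num)
  have s70 := hswap 0 7 0 (by norm_num)
  have d0 := hdiag 14 0
  have d1 := hdiag 10 1
  have d2 := hdiag 6 2
  have d3 := hdiag 2 3
  norm_num at s10 s20 s21 s30 s31 s32 s40 s41 s42 s43 s50 s51 s52 s60 s61 s70 d0 d1 d2 d3
  rw [h4] at s70
  simp only [Finset.sum_range_succ, Finset.sum_range_zero, Fin.sum_univ_succ, expB, expC,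
    basisFun, Fin.sum_univ_zero, Matrix.cons_val_zero, Matrix.cons_val_succ]
  norm_num
  rw [s10, s20, s21, s30, s31, s32, s40, s41, s42, s43, s50, s51, s52, s60, s61, s70, d0, d1, d2,
    d3, h4]
  ring

open MvPolynomial in
theorem PolyMap.evalAt_cons (f : PolyMap) (x y z : ℂ) :
    f.evalAt ![x, y, z] =
      ![eval ![x, y, z] (f 0), eval ![x, y, z] (f 1), eval ![x, y, z] (f 2)] :=
  (cons_eta _).symm

theorem matZ_mulVec (x y z : ℂ) : matZ *ᵥ ![x, y, z] = ![x, -y, -z] := by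
  ext i
  fin_cases i <;> simp [matZ, Matrix.mulVec, dotProduct, Fin.sum_univ_three]

theorem matT_mulVec (x y z : ℂ) : matT *ᵥ ![x, y, z] = ![z, x, y] := by
  ext i
  fin_cases i <;> simp [matT, Matrix.mulVec, dotProduct, Fin.sum_univ_three]

theorem matQ_mulVec (x y z : ℂ) : matQ *ᵥ ![x, y, z] = ![x, rho ^ 2 * z, -rho * y] := by
  ext i
  fin_cases i <;> simp [matQ, Matrix.mulVec, dotProduct, Fin.sum_univ_three]

theorem two_smul_matP_mulVec (x y z : ℂ) :
    (2 : ℂ) • (matP *ᵥ ![x, y, z]) =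
      ![x + (tau - 1) * y - tau * z, (tau - 1) * x + tau * y + z, tau * x - y + (tau - 1) * z] := by
  ext i
  fin_cases i <;> simp [matP, tau_inv] <;> ring

open MvPolynomial in
/-- An equivariant of degree 16 is determined by one coefficient of its first coordinate. -/
theorem eq_zero_of_coeff_eq_zero {f : PolyMap} (hf : ∀ i, (f i).IsHomogeneous 16)
    (hZ : CommutesWith f matZ) (hT : CommutesWith f matT) (hP : CommutesWith f matP)
    (hQ : CommutesWith f matQ) (h0 : coeff (expVec 0 15 1) (f 0) = 0) : f = 0 := by
  have hT' : ∀ x y z, eval ![x, y, z] (f 2) = eval ![z, x, y] (f 0) ∧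
      eval ![x, y, z] (f 0) = eval ![z, x, y] (f 1) := by
    intro x y z
    have := hT ![x, y, z]
    rw [matT_mulVec, f.evalAt_cons, f.evalAt_cons, matT_mulVec] at this
    exact ⟨by simpa using (congrFun this 0).symm, by simpa using (congrFun this 1).symm⟩
  have e1 : ∀ x y z, eval ![x, y, z] (f 1) = eval ![y, z, x] (f 0) :=
    fun x y z => ((hT' y z x).2).symm
  have e2 : ∀ x y z, eval ![x, y, z] (f 2) = eval ![z, x, y] (f 0) := fun x y z => (hT' x y z).1
  have hZ' : ∀ x y z, eval ![x, -y, -z] (f 0) = eval ![x, y, z] (f 0) ∧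
      eval ![x, -y, -z] (f 1) = -eval ![x, y, z] (f 1) := by
    intro x y z
    have := hZ ![x, y, z]
    rw [matZ_mulVec, f.evalAt_cons, f.evalAt_cons, matZ_mulVec] at this
    exact ⟨by simpa using congrFun this 0, by simpa using congrFun this 1⟩
  have hQ' : ∀ x y z, eval ![x, rho ^ 2 * z, -rho * y] (f 0) = eval ![x, y, z] (f 0) := by
    intro x y z
    have := hQ ![x, y, z]
    rw [matQ_mulVec, f.evalAt_cons, f.evalAt_cons, matQ_mulVec] at this
    simpa using congrFun this 0
  -- Doubling `matP` clears denominators: degree 16 gives f(2Px) = 2^16 P f(x) = 2^15 (2P) f(x),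
  -- whose first coordinate is written here through `f 0` alone.
  have hP' : ∀ x y z, eval ![x + (tau - 1) * y - tau * z, (tau - 1) * x + tau * y + z,
      tau * x - y + (tau - 1) * z] (f 0) = 2 ^ 15 * (eval ![x, y, z] (f 0) +
        (tau - 1) * eval ![y, z, x] (f 0) - tau * eval ![z, x, y] (f 0)) := by
    intro x y z
    have h1 : f.evalAt ((2 : ℂ) • (matP *ᵥ ![x, y, z])) =
        (2 : ℂ) ^ 15 • (2 : ℂ) • (matP *ᵥ f.evalAt ![x, y, z]) := by
      rw [PolyMap.evalAt_smul hf, hP, smul_smul, pow_succ]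
    rw [two_smul_matP_mulVec, f.evalAt_cons x y z, two_smul_matP_mulVec, f.evalAt_cons] at h1
    have := congrFun h1 0
    simpa [e1, e2] using this
  have hsum := eval_eq_sum_basisFun (hf 0) (fun x y z => (hZ' x y z).1)
    -- The second coordinate of `matZ`-equivariance, shifted cyclically, is the odd sign change
    -- required of `f 0`.
    (fun x y z => by have := (hZ' z x y).2; rwa [e1, e1] at this) hQ' h0
  set C : Fin 15 → ℂ := fun j =>
    coeff (expVec (14 - 2 * expB j - 2 * expC j) (2 * expB j + 1) (2 * expC j + 1)) (f 0) with hC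
  have hmul : sampleMatrix tau rho *ᵥ C = 0 := by
    ext i
    have := hP' (samplePt i).1 (samplePt i).2.1 (samplePt i).2.2
    rw [hsum, hsum, hsum, hsum] at this
    simp only [Matrix.mulVec, dotProduct, sampleMatrix, Matrix.of_apply, defect, Pi.zero_apply]
    rw [← sub_eq_zero] at this
    rw [← this]
    simp only [Finset.mul_sum, ← Finset.sum_add_distrib, ← Finset.sum_sub_distrib]
    exact Finset.sum_congr rfl fun j _ => by ring
  have hC0 : C = 0 := Matrix.eq_zero_of_mulVec_eq_zero sampleMatrix_det_ne_zero hmul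
  have hz : ∀ x y z, eval ![x, y, z] (f 0) = 0 := by
    intro x y z
    rw [hsum]
    refine Finset.sum_eq_zero fun j _ => ?_
    have := congrFun hC0 j
    simp only [hC, Pi.zero_apply] at this
    rw [this, mul_zero]
  refine PolyMap.ext_evalAt fun x => ?_
  rw [← cons_eta x, f.evalAt_cons, e1, e2, hz, hz, hz]
  ext i
  fin_cases i <;> simp [PolyMap.evalAt]

/-! ### The invariants of degrees 6 and 12 -/

open MvPolynomial in
/-- The sextic forms that are invariant under the tetrahedral group and contain `x₁⁶` with
coefficient 1. -/
def sextic (a b c : ℂ) : MvPolynomial (Fin 3) ℂ :=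
  X 0 ^ 6 + X 1 ^ 6 + X 2 ^ 6 + C a * (X 0 ^ 2 * X 1 ^ 2 * X 2 ^ 2)
    + C b * (X 0 ^ 4 * X 1 ^ 2 + X 1 ^ 4 * X 2 ^ 2 + X 0 ^ 2 * X 2 ^ 4)
    + C c * (X 0 ^ 4 * X 2 ^ 2 + X 0 ^ 2 * X 1 ^ 4 + X 1 ^ 2 * X 2 ^ 4)

/-- The coefficient of `x₁²x₂²x₃²` in `F`. -/
def coeffA : ℂ := 18 - 6 * tau + (6 - 12 * tau) * rho

/-- The coefficient of `x₁⁴x₂²` in `F`. -/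
def coeffB : ℂ := -3 / 2 + 3 * tau + (-9 / 2 + 3 / 2 * tau) * rho

/-- The coefficient of `x₁⁴x₃²` in `F`. -/
def coeffC : ℂ := 9 / 2 - 3 / 2 * tau + (3 + 3 / 2 * tau) * rho

/-- This is √5 · √-3 with √-3 = 2ρ + 1; it puts the coefficients of F into the basis 1, τ, ρ, τρ. -/
theorem sqrtFifteen_mul_I : ((Real.sqrt 15 : ℝ) : ℂ) * Complex.I = sqrtFive * (2 * rho + 1) := by
  have h : (15 : ℝ) = 5 * 3 := by norm_num
  rw [rho_eq, sqrtFive, h, Real.sqrt_mul (by norm_num)]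
  push_cast
  ring

theorem sqrtFive_eq : sqrtFive = 2 * tau - 1 := by
  unfold tau; ring

theorem formF_eq_sextic : formF = sextic coeffA coeffB coeffC := by
  have hA : 3 * (5 - ((Real.sqrt 15 : ℝ) : ℂ) * Complex.I) = coeffA := by
    rw [sqrtFifteen_mul_I, sqrtFive_eq, coeffA]; ring
  have hB : (3 / 4 * (2 * sqrtFive - (5 - sqrtFive) * rho)) = coeffB := by
    rw [sqrtFive_eq, coeffB]; ring
  have hC : (3 / 4 * (2 * sqrtFive + (5 + sqrtFive) * rho ^ 2)) = -coeffC := by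
    rw [sqrtFive_eq, coeffC, rho_sq]; ring
  rw [formF, hA, hB, hC, sextic, MvPolynomial.C_neg]
  ring

open MvPolynomial in
theorem eval_sextic (a b c x y z : ℂ) : eval ![x, y, z] (sextic a b c) =
    x ^ 6 + y ^ 6 + z ^ 6 + a * (x ^ 2 * y ^ 2 * z ^ 2)
      + b * (x ^ 4 * y ^ 2 + y ^ 4 * z ^ 2 + x ^ 2 * z ^ 4)
      + c * (x ^ 4 * z ^ 2 + x ^ 2 * y ^ 4 + y ^ 2 * z ^ 4) := by
  simp [sextic]

theorem isHomogeneous_sextic (a b c : ℂ) : (sextic a b c).IsHomogeneous 6 := by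
  have hX : ∀ (i : Fin 3) (n : ℕ),
      (MvPolynomial.X i ^ n : MvPolynomial (Fin 3) ℂ).IsHomogeneous n :=
    fun i n => MvPolynomial.isHomogeneous_X_pow i n
  have hm : ∀ (i j : Fin 3) (m n : ℕ), (MvPolynomial.X i ^ m * MvPolynomial.X j ^ n :
      MvPolynomial (Fin 3) ℂ).IsHomogeneous (m + n) := fun i j m n => (hX i m).mul (hX j n)
  have hC : ∀ (k : ℂ) {p : MvPolynomial (Fin 3) ℂ}, p.IsHomogeneous 6 →
      (MvPolynomial.C k * p).IsHomogeneous 6 := fun k p hp => by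
    simpa using (MvPolynomial.isHomogeneous_C (Fin 3) k).mul hp
  exact (((((hX 0 6).add (hX 1 6)).add (hX 2 6)).add (hC a ((hm 0 1 2 2).mul (hX 2 2)))).add
    (hC b (((hm 0 1 4 2).add (hm 1 2 4 2)).add (hm 0 2 2 4)))).add
    (hC c (((hm 0 2 4 2).add (hm 0 1 2 4)).add (hm 1 2 2 4)))

open MvPolynomial in
theorem eval_formF_matZ (x y z : ℂ) :
    eval (matZ *ᵥ ![x, y, z]) formF = eval ![x, y, z] formF := by
  rw [matZ_mulVec, formF_eq_sextic, eval_sextic, eval_sextic]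
  ring

open MvPolynomial in
theorem eval_formF_matT (x y z : ℂ) :
    eval (matT *ᵥ ![x, y, z]) formF = eval ![x, y, z] formF := by
  rw [matT_mulVec, formF_eq_sextic, eval_sextic, eval_sextic]
  ring

-- The substitution interchanges the two cyclic sums of F term by term, up to powers of ρ, and these
-- powers are absorbed by ρ · `coeffB` = `coeffC`.
open MvPolynomial in
theorem eval_formF_matQ (x y z : ℂ) :
    eval (matQ *ᵥ ![x, y, z]) formF = eval ![x, y, z] formF := by
  have h1 : rho * coeffB = coeffC := by
    rw [coeffB, coeffC]; linear_combination (-9 / 2 + 3 / 2 * tau) * rho_sq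
  have h3 : rho ^ 2 * coeffC = coeffB := by
    rw [← h1]; linear_combination coeffB * rho_cube
  have h4 : rho ^ 4 = rho := by linear_combination rho * rho_cube
  have h6 : rho ^ 6 = 1 := by linear_combination (rho ^ 3 + 1) * rho_cube
  have h8 : rho ^ 8 = rho ^ 2 := by linear_combination (rho ^ 5 + rho ^ 2) * rho_cube
  rw [matQ_mulVec, formF_eq_sextic, eval_sextic, eval_sextic]
  ring_nf
  grind

open MvPolynomial in
/-- `F` as a combination of the invariants of degrees 2 and 6 of the icosahedral group. -/
theorem eval_formF_eq_icosahedral (x y z : ℂ) :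
    eval ![x, y, z] formF = (x ^ 2 + y ^ 2 + z ^ 2) ^ 3
      - (-12 + 15 / 2 * tau + (-21 / 2 + 6 * tau) * rho) *
        ((x - tau * y) * (x + tau * y) * ((y - tau * z) * (y + tau * z)) *
          ((z - tau * x) * (z + tau * x))) := by
  have h4 : tau ^ 4 = 3 * tau + 2 := by linear_combination (tau ^ 2 + tau + 2) * tau_sq
  have h6 : tau ^ 6 = 8 * tau + 5 := by
    linear_combination (tau ^ 4 + tau ^ 3 + 2 * tau ^ 2 + 3 * tau + 5) * tau_sq
  have hA : coeffA = 6 - (-12 + 15 / 2 * tau + (-21 / 2 + 6 * tau) * rho) * (1 - tau ^ 6) := by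
    rw [h6, coeffA]; linear_combination (-(60 + 48 * rho)) * tau_sq
  have hB : coeffB = 3 + (-12 + 15 / 2 * tau + (-21 / 2 + 6 * tau) * rho) * tau ^ 2 := by
    rw [coeffB]
    grind [tau_sq]
  have hC : coeffC = 3 - (-12 + 15 / 2 * tau + (-21 / 2 + 6 * tau) * rho) * tau ^ 4 := by
    rw [h4, coeffC]
    grind [tau_sq]
  rw [formF_eq_sextic, eval_sextic, hA, hB, hC]
  ring

-- In the icosahedral form of F, the rotation preserves the quadratic form and permutes the six
-- linear factors up to sign. Four of the signs are negative, so the product is unchanged.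
open MvPolynomial in
theorem eval_formF_matP (x y z : ℂ) :
    eval (matP *ᵥ ![x, y, z]) formF = eval ![x, y, z] formF := by
  have hP : matP *ᵥ ![x, y, z] = ![(x + (tau - 1) * y - tau * z) / 2,
      ((tau - 1) * x + tau * y + z) / 2, (tau * x - y + (tau - 1) * z) / 2] := by
    have h := congrArg (fun v => (2 : ℂ)⁻¹ • v) (two_smul_matP_mulVec x y z)
    simp only [inv_smul_smul₀ (two_ne_zero : (2 : ℂ) ≠ 0)] at h
    rw [h]
    ext i
    fin_cases i <;> simp <;> ring
  rw [hP, eval_formF_eq_icosahedral, eval_formF_eq_icosahedral]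
  set u := (x + (tau - 1) * y - tau * z) / 2 with hu
  set v := ((tau - 1) * x + tau * y + z) / 2 with hv
  set w := (tau * x - y + (tau - 1) * z) / 2 with hw
  have hq : u ^ 2 + v ^ 2 + w ^ 2 = x ^ 2 + y ^ 2 + z ^ 2 := by
    rw [hu, hv, hw]; grind [tau_sq]
  have e1 : u - tau * v = -(y + tau * z) := by rw [hu, hv]; grind [tau_sq]
  have e2 : u + tau * v = x + tau * y := by rw [hu, hv]; grind [tau_sq]
  have e3 : v - tau * w = -(x - tau * y) := by rw [hv, hw]; grind [tau_sq]
  have e4 : v + tau * w = z + tau * x := by rw [hv, hw]; grind [tau_sq]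
  have e5 : w - tau * u = -(y - tau * z) := by rw [hw, hu]; grind [tau_sq]
  have e6 : w + tau * u = -(z - tau * x) := by rw [hw, hu]; grind [tau_sq]
  rw [hq, e1, e2, e3, e4, e5, e6]
  ring

/-! ### Linear substitutions -/

open MvPolynomial in
/-- The substitution `p(x) ↦ p(Ax)`. -/
def linSubst (A : Matrix (Fin 3) (Fin 3) ℂ) :
    MvPolynomial (Fin 3) ℂ →ₐ[ℂ] MvPolynomial (Fin 3) ℂ :=
  bind₁ fun i => ∑ j, C (A i j) * X j

open MvPolynomial in
theorem eval_linSubst (A : Matrix (Fin 3) (Fin 3) ℂ) (p : MvPolynomial (Fin 3) ℂ)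
    (x : Fin 3 → ℂ) : eval x (linSubst A p) = eval (A *ᵥ x) p := by
  rw [linSubst, eval_bind₁]
  congr 2
  ext i
  simp [Matrix.mulVec, dotProduct]

open MvPolynomial in
theorem pderiv_linSubst (A : Matrix (Fin 3) (Fin 3) ℂ) (p : MvPolynomial (Fin 3) ℂ) (j : Fin 3) :
    pderiv j (linSubst A p) = ∑ i, C (A i j) * linSubst A (pderiv i p) := by
  induction p using MvPolynomial.induction_on with
  | C a => simp [linSubst]
  | add p q hp hq => simp [hp, hq, mul_add, Finset.sum_add_distrib]
  | mul_X p i hp =>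
    have hX : pderiv j (linSubst A (X i)) = C (A i j) := by
      simp [linSubst, pderiv_X, Pi.single_apply]
    rw [map_mul, pderiv_mul, hp, hX]
    simp only [pderiv_mul, pderiv_X, Pi.single_apply, map_add, map_mul, mul_add,
      Finset.sum_add_distrib, Finset.sum_mul]
    simp [mul_comm, mul_left_comm]

-- The chain rule applied twice; a linear substitution contributes no second-derivative term.
open MvPolynomial in
theorem hessian_linSubst (A : Matrix (Fin 3) (Fin 3) ℂ) (p : MvPolynomial (Fin 3) ℂ) :
    hessian (linSubst A p) = (A.map C)ᵀ * (hessian p).map (linSubst A) * A.map C := by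
  ext1 i j
  simp only [hessian, Matrix.of_apply, pderiv_linSubst, map_sum, pderiv_C_mul, Matrix.mul_apply,
    Matrix.transpose_apply, Matrix.map_apply, Finset.mul_sum, Finset.sum_mul]
  refine Finset.sum_congr rfl fun k _ => Finset.sum_congr rfl fun l _ => ?_
  ring

open MvPolynomial in
theorem det_hessian_linSubst (A : Matrix (Fin 3) (Fin 3) ℂ) (p : MvPolynomial (Fin 3) ℂ) :
    (hessian (linSubst A p)).det = C (A.det ^ 2) * linSubst A (hessian p).det := by
  have h1 : (A.map (C : ℂ → MvPolynomial (Fin 3) ℂ)).det = C A.det :=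
    (RingHom.map_det C A).symm
  have h2 : ((hessian p).map (linSubst A)).det = linSubst A (hessian p).det :=
    (AlgHom.map_det (linSubst A) (hessian p)).symm
  rw [hessian_linSubst, Matrix.det_mul, Matrix.det_mul, Matrix.det_transpose, h1, h2, C_pow]
  ring

theorem linSubst_formPhi {A : Matrix (Fin 3) (Fin 3) ℂ} (hA : A.det = 1)
    (hF : linSubst A formF = formF) : linSubst A formPhi = formPhi := by
  have h := det_hessian_linSubst A formF
  rw [hF, hA, one_pow, MvPolynomial.C_1, one_mul] at h
  rw [formPhi, map_mul, ← h]
  simp [linSubst]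

theorem evalAt_grad_of_linSubst_eq {A : Matrix (Fin 3) (Fin 3) ℂ} {p : MvPolynomial (Fin 3) ℂ}
    (hp : linSubst A p = p) (x : Fin 3 → ℂ) :
    (grad p).evalAt x = Aᵀ *ᵥ (grad p).evalAt (A *ᵥ x) := by
  ext j
  conv_lhs => rw [← hp]
  simp [PolyMap.evalAt, grad, pderiv_linSubst, Matrix.mulVec, dotProduct, eval_linSubst]

/-- The cross product of Aᵀu and Aᵀv is adj(A) applied to u × v, and A · adj(A) = det A. In this
form no inverse of A is needed. -/
theorem mulVec_cross_transpose_mulVec (A : Matrix (Fin 3) (Fin 3) ℂ) (u v : Fin 3 → ℂ) :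
    A *ᵥ crossProduct (Aᵀ *ᵥ u) (Aᵀ *ᵥ v) = A.det • crossProduct u v := by
  ext i
  fin_cases i <;>
    simp [cross_apply, Matrix.mulVec, dotProduct, Fin.sum_univ_three, Matrix.det_fin_three] <;>
    ring

theorem evalAt_cross (f g : PolyMap) (x : Fin 3 → ℂ) :
    PolyMap.evalAt (crossProduct f g) x = crossProduct (f.evalAt x) (g.evalAt x) := by
  ext i
  fin_cases i <;> simp [PolyMap.evalAt, cross_apply]

theorem commutesWith_psi16 {A : Matrix (Fin 3) (Fin 3) ℂ} (hA : A.det = 1)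
    (hF : ∀ x, MvPolynomial.eval (A *ᵥ x) formF = MvPolynomial.eval x formF) :
    CommutesWith psi16 A := by
  have hF' : linSubst A formF = formF := MvPolynomial.funext fun x => by rw [eval_linSubst, hF]
  intro x
  rw [psi16, evalAt_cross, evalAt_cross, evalAt_grad_of_linSubst_eq hF' x,
    evalAt_grad_of_linSubst_eq (linSubst_formPhi hA hF') x, mulVec_cross_transpose_mulVec, hA,
    one_smul]

/-! ### The degree of `ψ₁₆`, and its non-vanishing -/

theorem isHomogeneous_det_of {M : Matrix (Fin 3) (Fin 3) (MvPolynomial (Fin 3) ℂ)} {n : ℕ}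
    (hM : ∀ i j, (M i j).IsHomogeneous n) : M.det.IsHomogeneous (3 * n) := by
  have h : ∀ i j k l i' j', (M i j * M k l * M i' j').IsHomogeneous (3 * n) := by
    intro i j k l i' j'
    have := ((hM i j).mul (hM k l)).mul (hM i' j')
    rwa [show n + n + n = 3 * n by ring] at this
  rw [Matrix.det_fin_three]
  exact ((((((h _ _ _ _ _ _).sub (h _ _ _ _ _ _)).sub (h _ _ _ _ _ _)).add
    (h _ _ _ _ _ _)).add (h _ _ _ _ _ _)).sub (h _ _ _ _ _ _))

theorem isHomogeneous_formF : formF.IsHomogeneous 6 := by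
  rw [formF_eq_sextic]
  exact isHomogeneous_sextic _ _ _

theorem isHomogeneous_formPhi : formPhi.IsHomogeneous 12 := by
  have := isHomogeneous_det_of (M := hessian formF) (n := 4)
    fun i j => isHomogeneous_formF.pderiv.pderiv
  simpa [formPhi] using (MvPolynomial.isHomogeneous_C (Fin 3) (-1 / 20250 : ℂ)).mul this

theorem isHomogeneous_psi16 (i : Fin 3) : (psi16 i).IsHomogeneous 16 := by
  have h : ∀ j k l m, (grad formF j * grad formPhi k - grad formF l * grad formPhi m).IsHomogeneous
      -- Each term has degree 5 + 11.
      16 := fun j k l m =>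
    ((isHomogeneous_formF.pderiv (i := j)).mul (isHomogeneous_formPhi.pderiv (i := k))).sub
      ((isHomogeneous_formF.pderiv (i := l)).mul (isHomogeneous_formPhi.pderiv (i := m)))
  rw [psi16, cross_apply]
  fin_cases i <;> exact h _ _ _ _

-- F is even in x₃, so at a point with x₃ = 0 the Hessian matrix and its derivatives along x₁ and x₂
-- are block diagonal. This makes (1,1,0) a convenient point at which to show `psi16` is nonzero.
open MvPolynomial in
theorem eval_hessian_formF :
    (eval ![1, 1, 0]).mapMatrix (hessian formF) =
      !![30 + 12 * coeffB + 2 * coeffC, 8 * coeffB + 8 * coeffC, 0;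
        8 * coeffB + 8 * coeffC, 30 + 2 * coeffB + 12 * coeffC, 0;
        0, 0, 2 * coeffA + 2 * coeffB + 2 * coeffC] := by
  ext i j
  fin_cases i <;> fin_cases j <;>
    simp [hessian, formF_eq_sextic, sextic, pderiv_X, Pi.single_apply, -Nat.cast_ofNat] <;>
    push_cast <;>
    ring

open MvPolynomial in
theorem eval_pderiv_zero_hessian_formF :
    (eval ![1, 1, 0]).mapMatrix ((hessian formF).map (pderiv 0)) =
      !![120 + 24 * coeffB, 24 * coeffB + 8 * coeffC, 0;
        24 * coeffB + 8 * coeffC, 8 * coeffB + 24 * coeffC, 0;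
        0, 0, 4 * coeffA + 8 * coeffC] := by
  ext i j
  fin_cases i <;> fin_cases j <;>
    simp [hessian, formF_eq_sextic, sextic, pderiv_X, Pi.single_apply, -Nat.cast_ofNat] <;>
    push_cast <;>
    ring

open MvPolynomial in
theorem eval_pderiv_one_hessian_formF :
    (eval ![1, 1, 0]).mapMatrix ((hessian formF).map (pderiv 1)) =
      !![24 * coeffB + 8 * coeffC, 8 * coeffB + 24 * coeffC, 0;
        8 * coeffB + 24 * coeffC, 120 + 24 * coeffC, 0;
        0, 0, 4 * coeffA + 8 * coeffB] := by
  ext i j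
  fin_cases i <;> fin_cases j <;>
    simp [hessian, formF_eq_sextic, sextic, pderiv_X, Pi.single_apply, -Nat.cast_ofNat] <;>
    push_cast <;>
    ring

open MvPolynomial in
/-- The derivative of a determinant, at a point where the matrix and its derivative are block
diagonal. -/
theorem eval_pderiv_det_of_block {M : Matrix (Fin 3) (Fin 3) (MvPolynomial (Fin 3) ℂ)} {k : Fin 3}
    {x : Fin 3 → ℂ} {a b c d a' b' c' d' : ℂ}
    (hM : (eval x).mapMatrix M = !![a, b, 0; b, c, 0; 0, 0, d])
    (hM' : (eval x).mapMatrix (M.map (pderiv k)) = !![a', b', 0; b', c', 0; 0, 0, d']) :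
    eval x (pderiv k M.det) =
      d' * (a * c - b * b) + d * (a' * c + a * c' - 2 * b * b') := by
  have h : ∀ i j, eval x (M i j) = !![a, b, 0; b, c, 0; 0, 0, d] i j := fun i j =>
    congrFun (congrFun hM i) j
  have h' : ∀ i j, eval x (pderiv k (M i j)) = !![a', b', 0; b', c', 0; 0, 0, d'] i j :=
    fun i j => congrFun (congrFun hM' i) j
  simp only [Matrix.det_fin_three, map_add, map_sub, pderiv_mul, map_mul, h, h']
  simp
  ring

open MvPolynomial in
theorem eval_pderiv_zero_det_hessian_formF :
    eval ![1, 1, 0] (pderiv 0 (hessian formF).det) =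
      1093500 - 89100 * tau + (162000 + 283500 * tau) * rho := by
  rw [eval_pderiv_det_of_block eval_hessian_formF eval_pderiv_zero_hessian_formF, coeffA, coeffB,
    coeffC]
  grind [tau_sq, rho_sq]

open MvPolynomial in
theorem eval_pderiv_one_det_hessian_formF :
    eval ![1, 1, 0] (pderiv 1 (hessian formF).det) =
      558900 + 372600 * tau + (-445500 + 283500 * tau) * rho := by
  rw [eval_pderiv_det_of_block eval_hessian_formF eval_pderiv_one_hessian_formF, coeffA, coeffB,
    coeffC]
  grind [tau_sq, rho_sq]

open MvPolynomial in
theorem eval_psi16_two : eval ![1, 1, 0] (psi16 2) = 960 - 1152 * tau + 768 * rho := by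
  have hF0 : eval ![1, 1, 0] (pderiv 0 formF) = 6 + 4 * coeffB + 2 * coeffC := by
    simp [formF_eq_sextic, sextic, pderiv_X]
    ring
  have hF1 : eval ![1, 1, 0] (pderiv 1 formF) = 6 + 2 * coeffB + 4 * coeffC := by
    simp [formF_eq_sextic, sextic, pderiv_X]
    ring
  have h : psi16 2 = pderiv 0 formF * pderiv 1 formPhi - pderiv 1 formF * pderiv 0 formPhi := rfl
  rw [h, formPhi, pderiv_C_mul, pderiv_C_mul, map_sub, map_mul, map_mul, map_mul, map_mul, eval_C,
    hF0, hF1, eval_pderiv_zero_det_hessian_formF, eval_pderiv_one_det_hessian_formF, coeffB, coeffC]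
  grind [tau_sq, rho_sq]

theorem psi16_ne_zero : psi16 ≠ 0 := by
  intro h
  have h1 := eval_psi16_two
  rw [h, Pi.zero_apply, map_zero] at h1
  have h2 : ((960 : ℤ) + (-1152 : ℤ) * tau + ((768 : ℤ) + (0 : ℤ) * tau) * rho : ℂ) = 0 := by
    rw [h1]; push_cast; ring
  exact absurd (int_combination_eq_zero h2).1 (by norm_num)

/-! ### Equivariance under the Valentiner group -/

/-- The inclusion of `SU₃` into `GL₃(ℂ)`. -/
def toGL : SU3 →* GL (Fin 3) ℂ :=
  MonoidHom.toHomUnits (Matrix.specialUnitaryGroup (Fin 3) ℂ).subtype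

theorem coe_toGL (T : SU3) : (toGL T : Matrix (Fin 3) (Fin 3) ℂ) = T := rfl

/-- The group of all matrices of determinant 1 that leave `F` invariant. -/
def formFGroup : Subgroup (GL (Fin 3) ℂ) where
  carrier := {A | (A : Matrix (Fin 3) (Fin 3) ℂ).det = 1 ∧
    ∀ x, MvPolynomial.eval ((A : Matrix (Fin 3) (Fin 3) ℂ) *ᵥ x) formF =
      MvPolynomial.eval x formF}
  one_mem' := ⟨by simp, fun x => by simp⟩
  mul_mem' := by
    rintro A B ⟨hA, hA'⟩ ⟨hB, hB'⟩
    refine ⟨by simp [hA, hB], fun x => ?_⟩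
    rw [Units.val_mul, ← Matrix.mulVec_mulVec, hA', hB']
  inv_mem' := by
    rintro A ⟨hA, hA'⟩
    have hinv : (A : Matrix (Fin 3) (Fin 3) ℂ) * ((A⁻¹ : GL (Fin 3) ℂ) : Matrix _ _ ℂ) = 1 :=
      A.mul_inv
    refine ⟨?_, fun x => ?_⟩
    · have := congrArg Matrix.det hinv
      rwa [Matrix.det_mul, hA, one_mul, Matrix.det_one] at this
    · rw [← hA', Matrix.mulVec_mulVec, hinv, Matrix.one_mulVec]

theorem toGL_mem_formFGroup {M : Matrix (Fin 3) (Fin 3) ℂ}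
    (hM : M ∈ Matrix.specialUnitaryGroup (Fin 3) ℂ)
    (hF : ∀ x y z, MvPolynomial.eval (M *ᵥ ![x, y, z]) formF =
      MvPolynomial.eval ![x, y, z] formF) : toGL ⟨M, hM⟩ ∈ formFGroup :=
  ⟨(Matrix.mem_specialUnitaryGroup_iff.1 hM).2, fun x => by
    have := hF (x 0) (x 1) (x 2)
    rwa [cons_eta] at this⟩

/-- Each generator has a lift of determinant 1 that fixes F, and such lifts form a group; no list of
the elements of the Valentiner group is needed. -/
theorem valentinerGroup_le : valentinerGroup ≤ formFGroup.map Matrix.ProjGenLinGroup.mk := by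
  rw [valentinerGroup, Subgroup.closure_le]
  rintro v (rfl | rfl | rfl | rfl)
  · exact ⟨toGL ⟨matZ, matZ_mem⟩, toGL_mem_formFGroup _ eval_formF_matZ, rfl⟩
  · exact ⟨toGL ⟨matT, matT_mem⟩, toGL_mem_formFGroup _ eval_formF_matT, rfl⟩
  · exact ⟨toGL ⟨matP, matP_mem⟩, toGL_mem_formFGroup _ eval_formF_matP, rfl⟩
  · exact ⟨toGL ⟨matQ, matQ_mem⟩, toGL_mem_formFGroup _ eval_formF_matQ, rfl⟩

theorem mem_valentinerGroup_of_mem_generators {v : PGL(3, ℂ)}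
    (hv : v ∈ ({toPGL ⟨matZ, matZ_mem⟩, toPGL ⟨matT, matT_mem⟩, toPGL ⟨matP, matP_mem⟩,
      toPGL ⟨matQ, matQ_mem⟩} : Set PGL(3, ℂ))) : v ∈ valentinerGroup :=
  Subgroup.subset_closure hv

/-- A representative of an element of the Valentiner group is a multiple of a matrix of
determinant 1 that commutes with `ψ₁₆`. -/
theorem exists_eq_smul_of_mk_mem {A : GL (Fin 3) ℂ}
    (hA : (Matrix.ProjGenLinGroup.mk A : PGL(3, ℂ)) ∈ valentinerGroup) :
    ∃ (B : Matrix (Fin 3) (Fin 3) ℂ) (c : ℂ), c ≠ 0 ∧ B.det = 1 ∧ CommutesWith psi16 B ∧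
      (A : Matrix (Fin 3) (Fin 3) ℂ) = c • B := by
  obtain ⟨w, ⟨hdet, hF⟩, hw⟩ := valentinerGroup_le hA
  obtain ⟨u, rfl⟩ := Matrix.ProjGenLinGroup.mk_eq_mk_iff.1 hw
  refine ⟨w, u, u.ne_zero, hdet, commutesWith_psi16 hdet hF, ?_⟩
  ext i j
  simp [Matrix.mul_apply, Matrix.scalar_apply, Matrix.diagonal_apply, mul_comm]

theorem evalAt_psi16_smul_mulVec {B : Matrix (Fin 3) (Fin 3) ℂ} (hB : CommutesWith psi16 B)
    (c : ℂ) (x : Fin 3 → ℂ) :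
    psi16.evalAt ((c • B) *ᵥ x) = c ^ 15 • ((c • B) *ᵥ psi16.evalAt x) := by
  rw [Matrix.smul_mulVec, PolyMap.evalAt_smul isHomogeneous_psi16, hB, Matrix.smul_mulVec,
    smul_smul, ← pow_succ]

theorem psi16_mem_equivariantMaps : psi16 ∈ equivariantMaps linearValentinerGroup 16 := by
  refine ⟨isHomogeneous_psi16, fun T hT x => ?_⟩
  obtain ⟨B, c, -, hdet, hB, hT'⟩ := exists_eq_smul_of_mk_mem (A := toGL T) hT
  rw [coe_toGL] at hT'
  -- Both matrices have determinant 1, so the scalar between them is a cube root of unity.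
  have hc : c ^ 3 = 1 := by
    have h1 := congrArg Matrix.det hT'
    rw [(Matrix.mem_specialUnitaryGroup_iff.1 T.2).2, Matrix.det_smul, hdet] at h1
    simpa using h1.symm
  have hc' : c ^ 15 = 1 := by
    rw [show 15 = 3 * 5 by norm_num, pow_mul, hc, one_pow]
  rw [hT', evalAt_psi16_smul_mulVec hB, hc', one_smul]

theorem evalAt_smul_map (c : ℂ) (f : PolyMap) (x : Fin 3 → ℂ) :
    PolyMap.evalAt (c • f) x = c • f.evalAt x := by
  ext i
  simp [PolyMap.evalAt]

theorem evalAt_sub_map (f g : PolyMap) (x : Fin 3 → ℂ) :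
    PolyMap.evalAt (f - g) x = f.evalAt x - g.evalAt x := by
  ext i
  simp [PolyMap.evalAt]

theorem CommutesWith.sub_smul {f g : PolyMap} {A : Matrix (Fin 3) (Fin 3) ℂ}
    (hf : CommutesWith f A) (hg : CommutesWith g A) (c : ℂ) : CommutesWith (f - c • g) A := by
  intro x
  rw [evalAt_sub_map, evalAt_sub_map, evalAt_smul_map, evalAt_smul_map, hf, hg,
    Matrix.mulVec_sub, Matrix.mulVec_smul]

theorem commutesWith_of_mem_equivariantMaps {f : PolyMap}
    (hf : f ∈ equivariantMaps linearValentinerGroup 16) :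
    CommutesWith f matZ ∧ CommutesWith f matT ∧ CommutesWith f matP ∧ CommutesWith f matQ :=
  ⟨hf.2 ⟨matZ, matZ_mem⟩ (mem_valentinerGroup_of_mem_generators (.inl rfl)),
    hf.2 ⟨matT, matT_mem⟩ (mem_valentinerGroup_of_mem_generators (.inr (.inl rfl))),
    hf.2 ⟨matP, matP_mem⟩ (mem_valentinerGroup_of_mem_generators (.inr (.inr (.inl rfl)))),
    hf.2 ⟨matQ, matQ_mem⟩ (mem_valentinerGroup_of_mem_generators (.inr (.inr (.inr rfl))))⟩

/-- Subtract the multiple of `psi16` that cancels the coefficient of y^15 z in the first coordinate.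
That coefficient of `psi16` is nonzero, as otherwise `psi16` itself would vanish by the same
criterion. -/
theorem mem_span_psi16 {f : PolyMap} (hf : ∀ i, (f i).IsHomogeneous 16)
    (hZ : CommutesWith f matZ) (hT : CommutesWith f matT) (hP : CommutesWith f matP)
    (hQ : CommutesWith f matQ) : f ∈ Submodule.span ℂ {psi16} := by
  obtain ⟨kZ, kT, kP, kQ⟩ := commutesWith_of_mem_equivariantMaps psi16_mem_equivariantMaps
  set d := expVec 0 15 1
  have hd : MvPolynomial.coeff d (psi16 0) ≠ 0 := fun h =>
    psi16_ne_zero (eq_zero_of_coeff_eq_zero isHomogeneous_psi16 kZ kT kP kQ h)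
  set c := MvPolynomial.coeff d (f 0) / MvPolynomial.coeff d (psi16 0) with hc
  have h0 : f - c • psi16 = 0 := by
    refine eq_zero_of_coeff_eq_zero (fun i => (hf i).sub ?_) (hZ.sub_smul kZ c)
      (hT.sub_smul kT c) (hP.sub_smul kP c) (hQ.sub_smul kQ c) ?_
    · rw [Pi.smul_apply, MvPolynomial.smul_eq_C_mul]
      simpa using (MvPolynomial.isHomogeneous_C (Fin 3) c).mul (isHomogeneous_psi16 i)
    · rw [Pi.sub_apply, Pi.smul_apply, MvPolynomial.coeff_sub, MvPolynomial.coeff_smul,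
        smul_eq_mul, hc, div_mul_cancel₀ _ hd, sub_self]
  rw [sub_eq_zero.1 h0]
  exact Submodule.smul_mem _ _ (Submodule.mem_span_singleton_self _)

theorem equivariantMaps_eq_span :
    equivariantMaps linearValentinerGroup 16 = Submodule.span ℂ {psi16} := by
  refine le_antisymm (fun f hf => ?_) ?_
  · obtain ⟨hZ, hT, hP, hQ⟩ := commutesWith_of_mem_equivariantMaps hf
    exact mem_span_psi16 hf.1 hZ hT hP hQ
  · rw [Submodule.span_singleton_le_iff_mem]
    exact psi16_mem_equivariantMaps

/-! ### Projective equivariance -/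

/-- Equivariance of a polynomial map under a matrix up to the factor `c`. -/
def SemiCommutesWith (f : PolyMap) (A : Matrix (Fin 3) (Fin 3) ℂ) (c : ℂ) : Prop :=
  ∀ x, f.evalAt (A *ᵥ x) = c • (A *ᵥ f.evalAt x)

theorem SemiCommutesWith.mul {f : PolyMap} {A B : Matrix (Fin 3) (Fin 3) ℂ} {c d : ℂ}
    (hA : SemiCommutesWith f A c) (hB : SemiCommutesWith f B d) :
    SemiCommutesWith f (A * B) (c * d) := by
  intro x
  rw [← Matrix.mulVec_mulVec, hA, hB, Matrix.mulVec_smul, smul_smul, Matrix.mulVec_mulVec]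

theorem SemiCommutesWith.eq_one {f : PolyMap} (hf : f ≠ 0) {c : ℂ} (h : SemiCommutesWith f 1 c) :
    c = 1 := by
  by_contra hc
  refine hf (PolyMap.ext_evalAt fun x => ?_)
  have hx := h x
  rw [Matrix.one_mulVec, Matrix.one_mulVec] at hx
  have h1 : (c - 1) • f.evalAt x = 0 := by rw [sub_smul, one_smul, ← hx, sub_self]
  rw [(smul_eq_zero.1 h1).resolve_left (sub_ne_zero.2 hc)]
  ext i
  simp [PolyMap.evalAt]

theorem SemiCommutesWith.commutesWith {f : PolyMap} {A : Matrix (Fin 3) (Fin 3) ℂ}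
    (h : SemiCommutesWith f A 1) : CommutesWith f A := fun x => by rw [h x, one_smul]

/-! ### Relations between the generators, exact and not merely projective -/

theorem matZ_sq : matZ * matZ = 1 := by
  ext i j
  fin_cases i <;> fin_cases j <;> simp [matZ, Matrix.mul_apply, Fin.sum_univ_three]

theorem matT_cube : matT * matT * matT = 1 := by
  ext i j
  fin_cases i <;> fin_cases j <;> simp [matT, Matrix.mul_apply, Fin.sum_univ_three]

theorem matZ_mul_matT_cube : matZ * matT * (matZ * matT) * (matZ * matT) = 1 := by
  ext i j
  fin_cases i <;> fin_cases j <;> simp [matZ, matT, Matrix.mul_apply, Fin.sum_univ_three]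

theorem matQ_sq_mul_matZ : matQ * matQ * matZ = 1 := by
  have h := rho_cube
  ext i j
  fin_cases i <;> fin_cases j <;>
    simp [matQ, matZ, Matrix.mul_apply, Fin.sum_univ_three] <;> grind

theorem matP_sq : matP * matP = !![(1 - tau) / 2, tau / 2, -1 / 2;
    tau / 2, 1 / 2, (tau - 1) / 2; 1 / 2, (1 - tau) / 2, -tau / 2] := by
  ext i j
  fin_cases i <;> fin_cases j <;>
    simp [matP, Matrix.mul_apply, Fin.sum_univ_three, tau_inv] <;> grind [tau_sq]

theorem matP_pow_five : matP * matP * (matP * matP) * matP = 1 := by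
  -- The fourth power is written as the transpose of `matP`, which is its inverse.
  have h4 : matP * matP * (matP * matP) = !![1 / 2, (tau - 1) / 2, tau / 2;
      (tau - 1) / 2, tau / 2, -1 / 2; -tau / 2, 1 / 2, (tau - 1) / 2] := by
    rw [matP_sq]
    ext i j
    fin_cases i <;> fin_cases j <;>
      simp [Matrix.mul_apply, Fin.sum_univ_three] <;> grind [tau_sq]
  rw [h4]
  ext i j
  fin_cases i <;> fin_cases j <;>
    simp [matP, Matrix.mul_apply, Fin.sum_univ_three, tau_inv] <;> grind [tau_sq]

theorem matT_sq_mul_matP_sq : matT * matT * matP * (matT * matT * matP) = 1 := by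
  have h : matT * matT * matP = !![(tau - 1) / 2, tau / 2, 1 / 2;
      tau / 2, -1 / 2, (tau - 1) / 2; 1 / 2, (tau - 1) / 2, -tau / 2] := by
    ext i j
    fin_cases i <;> fin_cases j <;>
      simp [matT, matP, Matrix.mul_apply, Fin.sum_univ_three, tau_inv]
  rw [h]
  ext i j
  fin_cases i <;> fin_cases j <;>
    simp [Matrix.mul_apply, Fin.sum_univ_three] <;> grind [tau_sq]

theorem matP_sq_mul_matQ_cube :
    matP * matP * matQ * (matP * matP * matQ) * (matP * matP * matQ) = 1 := by
  have h : matP * matP * matQ = !![(1 - tau) / 2, rho / 2, (-tau - tau * rho) / 2;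
      tau / 2, (1 - tau) * rho / 2, (-1 - rho) / 2;
      1 / 2, tau * rho / 2, (-1 + tau - rho + tau * rho) / 2] := by
    rw [matP_sq]
    ext i j
    fin_cases i <;> fin_cases j <;>
      simp [matQ, Matrix.mul_apply, Fin.sum_univ_three, rho_sq] <;> ring
  have h2 : matP * matP * matQ * (matP * matP * matQ) = !![(1 - tau) / 2, tau / 2, 1 / 2;
      (-1 - rho) / 2, (-1 + tau - rho + tau * rho) / 2, (-tau - tau * rho) / 2;
      tau * rho / 2, rho / 2, (1 - tau) * rho / 2] := by
    rw [h]
    ext i j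
    fin_cases i <;> fin_cases j <;>
      simp [Matrix.mul_apply, Fin.sum_univ_three] <;> grind [tau_sq, rho_sq]
  rw [h2, h]
  ext i j
  fin_cases i <;> fin_cases j <;>
    simp [Matrix.mul_apply, Fin.sum_univ_three] <;> grind [tau_sq, rho_sq]

/-- A projectively equivariant map commutes with the generators, since the relations between them
leave no room for a nontrivial character. -/
theorem IsProjEquivariant.commutesWith {f : PolyMap}
    (hf : IsProjEquivariant valentinerGroup f) :
    CommutesWith f matZ ∧ CommutesWith f matT ∧ CommutesWith f matP ∧ CommutesWith f matQ := by
  -- For the zero map the constants are not determined, so it is treated separately.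
  by_cases h0 : f = 0
  · subst h0
    have h : ∀ x, PolyMap.evalAt 0 x = 0 := fun x => by ext i; simp [PolyMap.evalAt]
    refine ⟨?_, ?_, ?_, ?_⟩ <;> intro x <;> rw [h, h, Matrix.mulVec_zero]
  obtain ⟨z, -, hz⟩ := hf (toGL ⟨matZ, matZ_mem⟩)
    (mem_valentinerGroup_of_mem_generators (.inl rfl))
  obtain ⟨t, -, ht⟩ := hf (toGL ⟨matT, matT_mem⟩)
    (mem_valentinerGroup_of_mem_generators (.inr (.inl rfl)))
  obtain ⟨p, -, hp⟩ := hf (toGL ⟨matP, matP_mem⟩)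
    (mem_valentinerGroup_of_mem_generators (.inr (.inr (.inl rfl))))
  obtain ⟨q, -, hq⟩ := hf (toGL ⟨matQ, matQ_mem⟩)
    (mem_valentinerGroup_of_mem_generators (.inr (.inr (.inr rfl))))
  replace hz : SemiCommutesWith f matZ z := hz
  replace ht : SemiCommutesWith f matT t := ht
  replace hp : SemiCommutesWith f matP p := hp
  replace hq : SemiCommutesWith f matQ q := hq
  have ez2 := (matZ_sq ▸ hz.mul hz).eq_one h0
  have et3 := (matT_cube ▸ (ht.mul ht).mul ht).eq_one h0
  have ezt := (matZ_mul_matT_cube ▸ ((hz.mul ht).mul (hz.mul ht)).mul (hz.mul ht)).eq_one h0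
  have eqz := (matQ_sq_mul_matZ ▸ (hq.mul hq).mul hz).eq_one h0
  have ep5 := (matP_pow_five ▸ ((hp.mul hp).mul (hp.mul hp)).mul hp).eq_one h0
  have etp := (matT_sq_mul_matP_sq ▸
    ((ht.mul ht).mul hp).mul ((ht.mul ht).mul hp)).eq_one h0
  have epq := (matP_sq_mul_matQ_cube ▸
    (((hp.mul hp).mul hq).mul ((hp.mul hp).mul hq)).mul ((hp.mul hp).mul hq)).eq_one h0
  -- From z² = t³ = (zt)³ = 1 follows z = 1. Next (t²p)² = 1 gives tp² = 1, whose cube gives p⁶ = 1;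
  -- with p⁵ = 1 this yields p = 1 and then t = 1. Finally q² = q³ = 1 gives q = 1.
  obtain rfl : z = 1 := by
    linear_combination ezt - z ^ 3 * et3 - z * ez2
  have htp : t * p ^ 2 = 1 := by linear_combination etp - t * p ^ 2 * et3
  obtain rfl : p = 1 := by
    linear_combination (t ^ 2 * p ^ 4 + t * p ^ 2 + 1) * htp - p ^ 6 * et3 - p * ep5
  obtain rfl : t = 1 := by linear_combination htp
  obtain rfl : q = 1 := by linear_combination epq - q * eqz
  exact ⟨hz.commutesWith, ht.commutesWith, hp.commutesWith, hq.commutesWith⟩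

theorem isProjEquivariant_smul_psi16 (k : ℂ) :
    IsProjEquivariant valentinerGroup (k • psi16) := by
  intro A hA
  obtain ⟨B, c, hc, -, hB, hA'⟩ := exists_eq_smul_of_mk_mem hA
  refine ⟨c ^ 15, pow_ne_zero _ hc, fun x => ?_⟩
  rw [evalAt_smul_map, evalAt_smul_map, hA', evalAt_psi16_smul_mulVec hB, Matrix.mulVec_smul,
    smul_comm]

theorem setOf_isProjEquivariant_eq_span :
    {f : PolyMap | (∀ i, (f i).IsHomogeneous 16) ∧ IsProjEquivariant valentinerGroup f} =
      (Submodule.span ℂ {psi16} : Set PolyMap) := by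
  ext f
  constructor
  · rintro ⟨hf, hf'⟩
    obtain ⟨hZ, hT, hP, hQ⟩ := hf'.commutesWith
    exact mem_span_psi16 hf hZ hT hP hQ
  · intro hf
    refine ⟨?_, ?_⟩
    · rw [← equivariantMaps_eq_span] at hf
      exact hf.1
    · obtain ⟨k, rfl⟩ := Submodule.mem_span_singleton.1 hf
      exact isProjEquivariant_smul_psi16 k

/-! ### Two-forms -/

/-- Evaluating on two vectors gives a triple product, which turns questions about 2-forms into cross
product identities. -/
theorem dotdX2_apply (f : PolyMap) (x : Fin 3 → ℂ) (u : Fin 2 → Fin 3 → ℂ) :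
    dotdX2 f x u = f.evalAt x ⬝ᵥ crossProduct (u 0) (u 1) := by
  simp [dotdX2, wedgeLin_apply, cross_apply, dotProduct, Fin.sum_univ_three]
  ring

/-- This is the Binet–Cauchy identity (a·u)(b·v) - (a·v)(b·u) = (a × b)·(u × v), applied to the
gradients. -/
theorem wedge_differential (p q : MvPolynomial (Fin 3) ℂ) :
    wedge (differential p) (differential q) = dotdX2 (crossProduct (grad p) (grad q)) := by
  funext x
  ext u
  rw [dotdX2_apply, wedge, wedgeLin_apply, evalAt_cross]
  simp [differential, cross_apply, dotProduct, Fin.sum_univ_three, PolyMap.evalAt, grad]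
  ring

/-- The map `f ↦ f · dX₂` as a linear map. -/
def dotdX2Lin : PolyMap →ₗ[ℂ] TwoForm where
  toFun := dotdX2
  map_add' f g := by
    funext x
    ext u
    have h : PolyMap.evalAt (f + g) x = f.evalAt x + g.evalAt x := by
      ext i
      simp [PolyMap.evalAt]
    simp [dotdX2_apply, h, add_dotProduct]
  map_smul' c f := by
    funext x
    ext u
    simp [dotdX2_apply, evalAt_smul_map]

theorem eq_of_forall_dotProduct_cross {a b : Fin 3 → ℂ}
    (h : ∀ u v, a ⬝ᵥ crossProduct u v = b ⬝ᵥ crossProduct u v) : a = b := by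
  have h0 := h ![0, 1, 0] ![0, 0, 1]
  have h1 := h ![0, 0, 1] ![1, 0, 0]
  have h2 := h ![1, 0, 0] ![0, 1, 0]
  simp [cross_apply, dotProduct, Fin.sum_univ_three] at h0 h1 h2
  ext i
  fin_cases i
  exacts [h0, h1, h2]

theorem dotdX2_injective : Function.Injective dotdX2 := by
  intro f g h
  refine PolyMap.ext_evalAt fun x => eq_of_forall_dotProduct_cross fun u v => ?_
  have := DFunLike.congr_fun (congrFun h x) ![u, v]
  simpa [dotdX2_apply] using this

theorem cross_mulVec_mulVec {T B : Matrix (Fin 3) (Fin 3) ℂ} (hB : B.det = 1) (h : B * T = 1)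
    (u v : Fin 3 → ℂ) : crossProduct (B *ᵥ u) (B *ᵥ v) = Tᵀ *ᵥ crossProduct u v := by
  have h1 := mulVec_cross_transpose_mulVec Bᵀ u v
  rw [Matrix.transpose_transpose, Matrix.det_transpose, hB, one_smul] at h1
  rw [← h1, Matrix.mulVec_mulVec, ← Matrix.transpose_mul, h, Matrix.transpose_one,
    Matrix.one_mulVec]

theorem coe_inv_mul (T : SU3) :
    ((T⁻¹ : SU3) : Matrix (Fin 3) (Fin 3) ℂ) * (T : Matrix (Fin 3) (Fin 3) ℂ) = 1 :=
  congrArg Subtype.val (inv_mul_cancel T)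

theorem coe_mul_inv (T : SU3) :
    (T : Matrix (Fin 3) (Fin 3) ℂ) * ((T⁻¹ : SU3) : Matrix (Fin 3) (Fin 3) ℂ) = 1 :=
  congrArg Subtype.val (mul_inv_cancel T)

theorem actOnTwoForm_dotdX2_apply (T : SU3) (f : PolyMap) (x : Fin 3 → ℂ)
    (u : Fin 2 → Fin 3 → ℂ) :
    actOnTwoForm T (dotdX2 f) x u =
      ((T : Matrix (Fin 3) (Fin 3) ℂ) *ᵥ
        f.evalAt (((T⁻¹ : SU3) : Matrix (Fin 3) (Fin 3) ℂ) *ᵥ x)) ⬝ᵥ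
          crossProduct (u 0) (u 1) := by
  have h : actOnTwoForm T (dotdX2 f) x u =
      dotdX2 f (((T⁻¹ : SU3) : Matrix (Fin 3) (Fin 3) ℂ) *ᵥ x)
        fun i => ((T⁻¹ : SU3) : Matrix (Fin 3) (Fin 3) ℂ) *ᵥ u i := rfl
  rw [h, dotdX2_apply, cross_mulVec_mulVec (Matrix.mem_specialUnitaryGroup_iff.1 (T⁻¹).2).2
    (coe_inv_mul T), Matrix.dotProduct_mulVec, Matrix.vecMul_transpose]

/-- Since det T = 1, pulling back f · dX₂ under T⁻¹ gives the form of the map x ↦ T f(T⁻¹x), so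
invariance of the form is equivariance of the map. -/
theorem actOnTwoForm_dotdX2_eq_iff (T : SU3) (f : PolyMap) :
    actOnTwoForm T (dotdX2 f) = dotdX2 f ↔ CommutesWith f T := by
  constructor
  · intro h x
    refine eq_of_forall_dotProduct_cross fun u v => ?_
    have := DFunLike.congr_fun (congrFun h ((T : Matrix (Fin 3) (Fin 3) ℂ) *ᵥ x)) ![u, v]
    rw [actOnTwoForm_dotdX2_apply, dotdX2_apply, Matrix.mulVec_mulVec, coe_inv_mul,
      Matrix.one_mulVec] at this
    exact this.symm
  · intro h
    funext x
    ext u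
    rw [actOnTwoForm_dotdX2_apply, dotdX2_apply, ← h, Matrix.mulVec_mulVec, coe_mul_inv,
      Matrix.one_mulVec]

/-- An alternating form is determined by its values on pairs of basis vectors, and antisymmetry
leaves only the three pairs listed. -/
theorem eq_dotdX2_of_coordinates {ω : TwoForm} {f : PolyMap}
    (h0 : ∀ x, ω x ![Pi.single 1 1, Pi.single 2 1] = MvPolynomial.eval x (f 0))
    (h1 : ∀ x, ω x ![Pi.single 2 1, Pi.single 0 1] = MvPolynomial.eval x (f 1))
    (h2 : ∀ x, ω x ![Pi.single 0 1, Pi.single 1 1] = MvPolynomial.eval x (f 2)) :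
    ω = dotdX2 f := by
  funext x
  have key : ∀ i j : Fin 3, ω x ![Pi.single i 1, Pi.single j 1] =
      dotdX2 f x ![Pi.single i 1, Pi.single j 1] := by
    have hswap : ∀ (η : (Fin 3 → ℂ) [⋀^Fin 2]→ₗ[ℂ] ℂ) (a b : Fin 3 → ℂ),
        η ![b, a] = -η ![a, b] := by
      intro η a b
      rw [← η.map_swap ![a, b] (zero_ne_one : (0 : Fin 2) ≠ 1)]
      congr 1
      ext i
      fin_cases i <;> simp
    have hself : ∀ (η : (Fin 3 → ℂ) [⋀^Fin 2]→ₗ[ℂ] ℂ) (a : Fin 3 → ℂ), η ![a, a] = 0 :=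
      fun η a => η.map_eq_zero_of_eq ![a, a] (i := 0) (j := 1) rfl zero_ne_one
    have e0 : ω x ![Pi.single 1 1, Pi.single 2 1] = dotdX2 f x ![Pi.single 1 1, Pi.single 2 1] := by
      rw [h0, dotdX2_apply]
      simp [cross_apply, dotProduct, Fin.sum_univ_three, PolyMap.evalAt]
    have e1 : ω x ![Pi.single 2 1, Pi.single 0 1] = dotdX2 f x ![Pi.single 2 1, Pi.single 0 1] := by
      rw [h1, dotdX2_apply]
      simp [cross_apply, dotProduct, Fin.sum_univ_three, PolyMap.evalAt]
    have e2 : ω x ![Pi.single 0 1, Pi.single 1 1] = dotdX2 f x ![Pi.single 0 1, Pi.single 1 1] := by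
      rw [h2, dotdX2_apply]
      simp [cross_apply, dotProduct, Fin.sum_univ_three, PolyMap.evalAt]
    intro i j
    fin_cases i <;> fin_cases j
    · exact (hself _ _).trans (hself _ _).symm
    · exact e2
    · exact (hswap _ _ _).trans ((congrArg Neg.neg e1).trans (hswap _ _ _).symm)
    · exact (hswap _ _ _).trans ((congrArg Neg.neg e2).trans (hswap _ _ _).symm)
    · exact (hself _ _).trans (hself _ _).symm
    · exact e0
    · exact e1
    · exact (hswap _ _ _).trans ((congrArg Neg.neg e0).trans (hswap _ _ _).symm)
    · exact (hself _ _).trans (hself _ _).symm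
  refine Module.Basis.ext_alternating (Pi.basisFun ℂ (Fin 3)) fun v _ => ?_
  have hv : (fun i => Pi.basisFun ℂ (Fin 3) (v i)) = ![Pi.single (v 0) 1, Pi.single (v 1) 1] := by
    ext i
    fin_cases i <;> simp [Pi.basisFun_apply]
  rw [hv]
  exact key _ _

open MvPolynomial in
theorem invariantTwoForms_eq_map (G : Subgroup SU3) (m : ℕ) :
    invariantTwoForms G m = (equivariantMaps G m).map dotdX2Lin := by
  ext ω
  constructor
  · rintro ⟨hpoly, hinv⟩
    -- The coefficients of the form are its values on the cyclically ordered pairs (e₂,e₃), (e₃,e₁),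
    -- (e₁,e₂), matching the order in dX₂.
    obtain ⟨p0, hp0, h0⟩ := hpoly ![Pi.single 1 1, Pi.single 2 1]
    obtain ⟨p1, hp1, h1⟩ := hpoly ![Pi.single 2 1, Pi.single 0 1]
    obtain ⟨p2, hp2, h2⟩ := hpoly ![Pi.single 0 1, Pi.single 1 1]
    obtain rfl : ω = dotdX2 ![p0, p1, p2] := eq_dotdX2_of_coordinates h0 h1 h2
    refine ⟨![p0, p1, p2], ⟨fun i => ?_, fun T hT => ?_⟩, rfl⟩
    · fin_cases i
      exacts [hp0, hp1, hp2]
    · exact (actOnTwoForm_dotdX2_eq_iff T _).1 (hinv T hT)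
  · rintro ⟨f, ⟨hf, hf'⟩, rfl⟩
    refine ⟨fun u => ⟨∑ i, f i * C (crossProduct (u 0) (u 1) i), ?_, fun x => ?_⟩,
      fun T hT => (actOnTwoForm_dotdX2_eq_iff T f).2 (hf' T hT)⟩
    · exact IsHomogeneous.sum _ _ _ fun i _ => by
        simpa using (hf i).mul (isHomogeneous_C (Fin 3) (crossProduct (u 0) (u 1) i))
    · change dotdX2 f x u = _
      rw [dotdX2_apply]
      simp [dotProduct, PolyMap.evalAt]

end Valentiner

end

/-- Up to scalar multiplication, `dF ∧ dΦ = (∇F × ∇Φ) · dX₂` is the unique invariant 2-form of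
degree 16 of the linear Valentiner group, and `ψ₁₆ = ∇F × ∇Φ` is the unique equivariant of
degree 16, under the linear group and under the projective one. -/
theorem mainTheorem6 :
    Valentiner.wedge (Valentiner.differential Valentiner.formF)
        (Valentiner.differential Valentiner.formPhi) =
      Valentiner.dotdX2 Valentiner.psi16 ∧
    Valentiner.invariantTwoForms Valentiner.linearValentinerGroup 16 =
      Submodule.span ℂ {Valentiner.wedge (Valentiner.differential Valentiner.formF)
        (Valentiner.differential Valentiner.formPhi)} ∧
    Module.finrank ℂ (Valentiner.invariantTwoForms Valentiner.linearValentinerGroup 16) = 1 ∧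
    Valentiner.equivariantMaps Valentiner.linearValentinerGroup 16 =
      Submodule.span ℂ {Valentiner.psi16} ∧
    Module.finrank ℂ (Valentiner.equivariantMaps Valentiner.linearValentinerGroup 16) = 1 ∧
    {f : Valentiner.PolyMap | (∀ i, (f i).IsHomogeneous 16) ∧
        Valentiner.IsProjEquivariant Valentiner.valentinerGroup f} =
      (Submodule.span ℂ {Valentiner.psi16} : Set Valentiner.PolyMap) := by
  have hw : Valentiner.wedge (Valentiner.differential Valentiner.formF)
      (Valentiner.differential Valentiner.formPhi) = Valentiner.dotdX2 Valentiner.psi16 :=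
    Valentiner.wedge_differential _ _
  have hspan : Valentiner.invariantTwoForms Valentiner.linearValentinerGroup 16 =
      Submodule.span ℂ {Valentiner.dotdX2 Valentiner.psi16} := by
    rw [Valentiner.invariantTwoForms_eq_map, Valentiner.equivariantMaps_eq_span,
      Submodule.map_span, Set.image_singleton]
    rfl
  have hne : Valentiner.dotdX2 Valentiner.psi16 ≠ 0 := fun h =>
    Valentiner.psi16_ne_zero
      (Valentiner.dotdX2_injective (h.trans (map_zero Valentiner.dotdX2Lin).symm))
  refine ⟨hw, hw ▸ hspan, ?_, Valentiner.equivariantMaps_eq_span, ?_,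
    Valentiner.setOf_isProjEquivariant_eq_span⟩
  · rw [hspan, finrank_span_singleton hne]
  · rw [Valentiner.equivariantMaps_eq_span, finrank_span_singleton Valentiner.psi16_ne_zero]
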